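/- Let $\mathbb R^{n,1}$ be Minkowski space, i.e. $\mathbb R^{n+1}$ with $\langle x,y\rangle=-x_0y_0+x_1y_1+\dots+x_ny_n$. A \emph{domain of dependence} (regular domain) is a nonempty open convex set $D\subset\mathbb R^{n,1}$ that is the intersection of the chronological futures of a family of lightlike hyperplanes and whose complement contains at least two non-parallel lightlike hyperplanes. Its cosmological time $\tau(p)$ is the supremum of the Lorentzian lengths of the future-directed causal curves in $D$ ending at $p$; put $H_\epsilon=\tau^{-1}(\epsilon)\subset D$ for $\epsilon>0$. The initial singularity $T\subset\partial D$ is the set of points $r\in\partial D$ for which there is $p\in D\cap I^+(r)$ with $\tau(p)=\sqrt{-\langle p-r,p-r\rangle}$. Let $v$ be a future-directed unit timelike vector and $P_v=v^\perp$, a Euclidean space with the induced metric and Lebesgue measure $dV$. Each of $\partial D$ and $H_\epsilon$ meets every line parallel to $v$ exactly once, hence they are the graphs $\{x+u(x)v\}$ and $\{x+u_\epsilon(x)v\}$ of functions $u,u_\epsilon:P_v\to\mathbb R$. With $\nu_\epsilon(x)=(1-\|\nabla u_\epsilon(x)\|^2)^{-1/2}(\nabla u_\epsilon(x)+v)$ the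 future-directed unit normal of $H_\epsilon$, put $\iota_\epsilon(x)=-\epsilon\langle\nu_\epsilon(x),v\rangle$; the \emph{intensity function} of $D$ is $\iota_v(x)=\lim_{\epsilon\to0^+}\iota_\epsilon(x)$, $x\in P_v$. The boundary of $D$ is called \emph{flat} if the distributional Laplacian of $u$ is a Radon measure $\mu$ on $P_v$ (that is, $\int u\,\Delta f\,dV=\int f\,d\mu$ for all $f\in C_c^\infty(P_v)$) which is concentrated on the initial singularity: $\mu(\{x\in P_v: x+u(x)v\notin T\})=0$. \textbf{Theorem.} Let $(D_k)_{k\in\mathbb N}$ be a sequence of domains of dependence in $\mathbb R^{n,1}$ converging to a domain of dependence $D$ in the Hausdorff sense on compact sets: for every compact $K\subset\mathbb R^{n,1}$ and every $\epsilon>0$, for all large $k$ the set $D_k\cap K$ lies in the $\epsilon$-neighbourhood of $D$ and $D\cap K$ lies in the $\epsilon$-neighbourhood of $D_k$. If the boundaries of $D$ and of all $D_k$ are flat, then the intensity functions $\iota_v^k$ of $D_k$ converge to the intensity function $\iota_v$ of $D$ strongly in $L^1_{loc}(P_v)$: all $\iota_v^k$ and $\iota_v$ are locally integrable on $P_v$,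 and $\int_K|\iota_v^k-\iota_v|\,dV\to0$ for every compact $K\subset P_v$. -/

import Mathlib

open MeasureTheory Set Filter Topology
open scoped ENNReal ContDiff

noncomputable section

namespace FlatSpacetime

/-! ## Minkowski space -/

/-- The manifold `ℝ^{n+1}` underlying `(n+1)`-dimensional Minkowski space. -/
abbrev Mink (n : ℕ) : Type := Fin (n + 1) → ℝ

/-- The Minkowski form `-x₀y₀ + x₁y₁ + … + xₙyₙ`. -/
def mform (n : ℕ) : LinearMap.BilinForm ℝ (Mink n) :=
  LinearMap.mk₂ ℝ (fun x y => -(x 0 * y 0) + ∑ i : Fin n, x i.succ * y i.succ)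
    (by
      intro x y z
      simp only [Pi.add_apply, add_mul, Finset.sum_add_distrib]
      ring)
    (by
      intro c x y
      simp only [Pi.smul_apply, smul_eq_mul, mul_add, Finset.mul_sum, mul_assoc]
      ring)
    (by
      intro x y z
      simp only [Pi.add_apply, mul_add, Finset.sum_add_distrib]
      ring)
    (by
      intro c x y
      simp only [Pi.smul_apply, smul_eq_mul, mul_add, Finset.mul_sum]
      congr 1
      · ring
      · exact Finset.sum_congr rfl fun i _ => by ring)

theorem mform_apply {n : ℕ} (x y : Mink n) :
    mform n x y = -(x 0 * y 0) + ∑ i : Fin n, x i.succ * y i.succ := rfl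

theorem mform_comm {n : ℕ} (x y : Mink n) : mform n x y = mform n y x := by
  simp only [mform_apply, mul_comm]

/-- `q - p` is timelike and future directed. -/
def ChronPrec {n : ℕ} (p q : Mink n) : Prop :=
  mform n (q - p) (q - p) < 0 ∧ p 0 < q 0

/-- The chronological future `I⁺(S)` of a set. -/
def chronFuture {n : ℕ} (S : Set (Mink n)) : Set (Mink n) :=
  {q | ∃ p ∈ S, ChronPrec p q}

/-- A lightlike affine hyperplane: a translate of the orthogonal space of a nonzero null vector. -/
def IsLightlikeHyperplane {n : ℕ} (P : AffineSubspace ℝ (Mink n)) : Prop :=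
  ∃ a l : Mink n, l ≠ 0 ∧ mform n l l = 0 ∧ P = AffineSubspace.mk' a (LinearMap.ker (mform n l))

/-- A (future complete) domain of dependence: a nonempty open convex set which is the intersection
of the futures of a family of lightlike hyperplanes, and whose complement contains at least two
non-parallel lightlike hyperplanes. -/
structure IsDomainOfDependence {n : ℕ} (D : Set (Mink n)) : Prop where
  isOpen : IsOpen D
  convex : Convex ℝ D
  nonempty : D.Nonempty
  eq_iInter : ∃ F : Set (AffineSubspace ℝ (Mink n)), (∀ P ∈ F, IsLightlikeHyperplane P) ∧
    D = ⋂ P ∈ F, chronFuture (P : Set (Mink n))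
  two_planes : ∃ P Q : AffineSubspace ℝ (Mink n), IsLightlikeHyperplane P ∧
    IsLightlikeHyperplane Q ∧ ¬ P.Parallel Q ∧ (P : Set (Mink n)) ⊆ Dᶜ ∧ (Q : Set (Mink n)) ⊆ Dᶜ

/-- Convergence of a sequence of domains: Hausdorff convergence on compact sets. -/
def DomainsConverge {n : ℕ} (Dk : ℕ → Set (Mink n)) (D : Set (Mink n)) : Prop :=
  ∀ K : Set (Mink n), IsCompact K → ∀ ε : ℝ, 0 < ε → ∀ᶠ k in atTop,
    Dk k ∩ K ⊆ Metric.thickening ε D ∧ D ∩ K ⊆ Metric.thickening ε (Dk k)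

/-! ## Cosmological time and the initial singularity -/

/-- `c`, restricted to `[0,1]`, is a future directed causal `C¹` curve in `D` ending at `p`. -/
structure IsCausalCurveTo {n : ℕ} (D : Set (Mink n)) (p : Mink n) (c : ℝ → Mink n) : Prop where
  contDiffOn : ContDiffOn ℝ 1 c (Icc 0 1)
  mapsTo : MapsTo c (Icc 0 1) D
  causal : ∀ t ∈ Icc (0 : ℝ) 1,
    mform n (derivWithin c (Icc 0 1) t) (derivWithin c (Icc 0 1) t) ≤ 0
  future : ∀ t ∈ Icc (0 : ℝ) 1, 0 < derivWithin c (Icc 0 1) t 0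
  endpoint : c 1 = p

/-- Lorentzian length of a causal curve parametrized by `[0,1]`. -/
def curveLength {n : ℕ} (c : ℝ → Mink n) : ℝ :=
  ∫ t in (0 : ℝ)..1,
    √(-(mform n (derivWithin c (Icc 0 1) t) (derivWithin c (Icc 0 1) t)))

/-- The cosmological time of `D`: the supremum of the lengths of the causal curves in `D`
ending at `p`. -/
def cosmoTime {n : ℕ} (D : Set (Mink n)) (p : Mink n) : ℝ≥0∞ :=
  ⨆ (c : ℝ → Mink n) (_ : IsCausalCurveTo D p c), ENNReal.ofReal (curveLength c)

/-- The level surface `H_ε` of the cosmological time. -/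
def levelSurface {n : ℕ} (D : Set (Mink n)) (ε : ℝ) : Set (Mink n) :=
  {p ∈ D | cosmoTime D p = ENNReal.ofReal ε}

/-- The initial singularity: the set of the points `r ∈ ∂D` such that some `p ∈ D ∩ I⁺(r)`
satisfies `τ(p) = |p - r|`. -/
def initialSingularity {n : ℕ} (D : Set (Mink n)) : Set (Mink n) :=
  {r ∈ frontier D | ∃ p ∈ D, ChronPrec r p ∧
    cosmoTime D p = ENNReal.ofReal √(-(mform n (p - r) (p - r)))}

/-! ## The Euclidean space `P_v` -/

/-- Hyperbolic space: the future directed unit timelike vectors. -/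
def Hyp (n : ℕ) : Type := {v : Mink n // mform n v v = -1 ∧ 0 < v 0}

/-- `P_v`, the spacelike hyperplane orthogonal to `v`. -/
def SpacePlane {n : ℕ} (v : Hyp n) : Type := ↥(LinearMap.ker (mform n v.1))

namespace SpacePlane

variable {n : ℕ} (v : Hyp n)

instance : AddCommGroup (SpacePlane v) :=
  inferInstanceAs (AddCommGroup ↥(LinearMap.ker (mform n v.1)))

instance : Module ℝ (SpacePlane v) :=
  inferInstanceAs (Module ℝ ↥(LinearMap.ker (mform n v.1)))

instance : FiniteDimensional ℝ (SpacePlane v) :=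
  inferInstanceAs (FiniteDimensional ℝ ↥(LinearMap.ker (mform n v.1)))

/-- The inclusion of `P_v` in Minkowski space. -/
def incl : SpacePlane v →ₗ[ℝ] Mink n := (LinearMap.ker (mform n v.1)).subtype

theorem incl_injective : Function.Injective (incl v) := Subtype.val_injective

theorem mform_incl (x : SpacePlane v) : mform n v.1 (incl v x) = 0 := x.2

theorem sum_sq_le (x : SpacePlane v) :
    ∑ i : Fin n, incl v x i.succ ^ 2 ≤ (v.1 0) ^ 2 * mform n (incl v x) (incl v x) := by
  have hv := v.2.1
  have hx := mform_incl v x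
  have hcs := Finset.sum_mul_sq_le_sq_mul_sq Finset.univ
    (fun i : Fin n => v.1 i.succ) (fun i : Fin n => incl v x i.succ)
  simp only [mform_apply, ← pow_two] at hv hx ⊢
  have h1 : ∑ i : Fin n, v.1 i.succ * incl v x i.succ = v.1 0 * incl v x 0 := by linarith
  have h2 : ∑ i : Fin n, v.1 i.succ ^ 2 = v.1 0 ^ 2 - 1 := by linarith
  rw [h1, h2] at hcs
  nlinarith [hcs]

/-- The Minkowski form restricts to a Euclidean inner product on `P_v`. -/
@[reducible] def core : InnerProductSpace.Core ℝ (SpacePlane v) where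
  inner x y := mform n (incl v x) (incl v y)
  conj_inner_symm x y := by simpa using mform_comm _ _
  re_inner_nonneg x := by
    have h := sum_sq_le v x
    have h0 : 0 ≤ ∑ i : Fin n, incl v x i.succ ^ 2 := Finset.sum_nonneg fun i _ => sq_nonneg _
    have hv : 0 < v.1 0 ^ 2 := pow_pos v.2.2 2
    exact nonneg_of_mul_nonneg_right (h0.trans h) hv
  add_left x y z := by simp
  smul_left x y r := by simp
  definite x hx := by
    have h := sum_sq_le v x
    rw [hx, mul_zero] at h
    have h0 : ∀ i : Fin n, incl v x i.succ = 0 := fun i => by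
      have := (Finset.sum_eq_zero_iff_of_nonneg (fun i _ => sq_nonneg (incl v x (Fin.succ i)))).1
        (le_antisymm h (Finset.sum_nonneg fun i _ => sq_nonneg _)) i (Finset.mem_univ i)
      exact pow_eq_zero_iff (two_ne_zero) |>.1 this
    have h1 : incl v x 0 = 0 := by
      have := mform_incl v x
      simp only [mform_apply, h0, mul_zero, Finset.sum_const_zero, add_zero, neg_eq_zero] at this
      exact (mul_eq_zero.1 this).resolve_left v.2.2.ne'
    apply incl_injective v
    rw [map_zero]
    funext i
    exact Fin.cases h1 h0 i

instance : NormedAddCommGroup (SpacePlane v) := (core v).toNormedAddCommGroup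

instance : InnerProductSpace ℝ (SpacePlane v) := InnerProductSpace.ofCore (core v).toCore

instance : CompleteSpace (SpacePlane v) := FiniteDimensional.complete ℝ _

instance : MeasurableSpace (SpacePlane v) := borel _

instance : BorelSpace (SpacePlane v) := ⟨rfl⟩

theorem inner_def (x y : SpacePlane v) : inner ℝ x y = mform n (incl v x) (incl v y) := rfl

end SpacePlane

/-! ## Intensity functions and flat boundaries -/

section Intensity

variable {n : ℕ} (v : Hyp n)

/-- The function on `P_v` whose graph is the hypersurface `H`, that is, `H = {x + u(x)v | x ∈ P_v}`
(used for hypersurfaces meeting each line parallel to `v` exactly once). -/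
def graphFun (H : Set (Mink n)) (x : SpacePlane v) : ℝ :=
  sInf {t : ℝ | SpacePlane.incl v x + t • v.1 ∈ H}

/-- The future directed unit normal of the graph of `u : P_v → ℝ` over `x`. -/
def unitNormal (u : SpacePlane v → ℝ) (x : SpacePlane v) : Mink n :=
  (1 / √(1 - ‖gradient u x‖ ^ 2)) • (SpacePlane.incl v (gradient u x) + v.1)

/-- `ι_ε`, the rescaled intensity of the level surface `H_ε`, as a function on `P_v`. -/
def levelIntensity (D : Set (Mink n)) (ε : ℝ) (x : SpacePlane v) : ℝ :=
  -ε * mform n (unitNormal v (graphFun v (levelSurface D ε)) x) v.1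

/-- The intensity function `ι_v`, the limit of `ι_ε` as `ε → 0`. -/
def intensity (D : Set (Mink n)) (x : SpacePlane v) : ℝ :=
  limUnder (𝓝[>] (0 : ℝ)) (fun ε => levelIntensity v D ε x)

/-- The measure `μ` is the distributional Laplacian of `u`. -/
def IsDistribLaplacian (u : SpacePlane v → ℝ) (μ : Measure (SpacePlane v)) : Prop :=
  ∀ f : SpacePlane v → ℝ, ContDiff ℝ ∞ f → HasCompactSupport f →
    ∫ x, u x * Laplacian.laplacian f x = ∫ x, f x ∂μ

/-- The boundary of `D` is flat: the distributional Laplacian of the function `u` on `P_v` with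
graph `∂D` is a Radon measure concentrated on the (projection of the) initial singularity. -/
def HasFlatBoundary (D : Set (Mink n)) : Prop :=
  ∃ μ : Measure (SpacePlane v), IsLocallyFiniteMeasure μ ∧
    IsDistribLaplacian v (graphFun v (frontier D)) μ ∧
    μ {x | SpacePlane.incl v x + graphFun v (frontier D) x • v.1 ∉ initialSingularity D} = 0

end Intensity

end FlatSpacetime

end

/-!
The boundary of a domain of dependence is the graph over `P_v` of a function `u` which has at every
point a subgradient of norm one (a null support plane) and lies above a spacelike hyperplane
(`IsNullHeight`, `IsDomainOfDependence.exists_isNullHeight`). Hausdorff convergence of domains gives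
pointwise convergence of these functions.

The level surface `H_ε` is the graph of the infimal convolution `inf_y u(y) + √(ε² + ‖x - y‖²)`. If
the infimum is attained at `y`, then the rescaled intensity at `x` is `√(ε² + ‖x - y‖²)`, and as
`ε → 0` it converges to the length `ι(x)` of the longest null segment of the graph of `u` ending
over `x` (`nullLength`, `IsEpigraph.intensity_eq`). Limits of null segments are null segments, so
`limsup ι_k ≤ ι` when `u_k → u`. It remains to see that no mass is lost in the limit.

This follows from the divergence of the vector field `ι ∇u`, where `∇u` is a unit vector almost
everywhere.

* The divergence is always at least one. The flow `Φ_t(x) = x + t ∇u(x)` expands distances, because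
  `∇u` is monotone, hence it does not decrease volumes; and it maps into `{ι ≥ t}`. Writing `ι` as
  the integral over `t` of the indicator functions of these sets gives
  `IsNullHeight.integral_testFn_le`.
* The divergence is at most one if the boundary is flat. The Lipschitz envelopes `j` of `ι` satisfy
  `⟪∇u, ∇j⟫ ≤ 1`, again because `Φ_t` expands distances, and integration by parts bounds the
  divergence of `j ∇u` by `1 + j μ`, where `μ` is the Laplacian of `u`. As `j` decreases to `ι`, the
  last term disappears, since `ι` vanishes on the initial singularity, which carries `μ`; see
  `IsNullHeight.integral_nullLength_mul_testWeight_le`.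

Both bounds are tested against `f = ((R - u - √(1 + ‖x‖²))⁺)²`, which has compact support and
decreases along the null rays. With `m = -⟪∇u, ∇f⟫ ≥ 0`, and `f_k`, `m_k` for `u_k`, the bounds read
`∫ ι m ≤ ∫ f` and `∫ f_k ≤ ∫ ι_k m_k`. Since `f_k → f` and `m_k → m`, this yields
`∫ ι m ≤ liminf ∫ ι_k m`, and together with `limsup ι_k ≤ ι` the convergence in `L¹` on compact
sets.
-/

namespace FlatSpacetime

open scoped RealInnerProductSpace NNReal

/-! ### Height functions of domains of dependence -/

section NullHeight

variable {E : Type*} [NormedAddCommGroup E] [InnerProductSpace ℝ E]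

/-- `e` is a subgradient of `u` at `x`. -/
def IsSubgrad (u : E → ℝ) (x e : E) : Prop := ∀ y, u x + ⟪e, y - x⟫ ≤ u y

/-- The functions whose strict epigraph is a domain of dependence: at every point there is a
supporting affine function with unit slope (a null support plane), and the graph lies above a
spacelike hyperplane. -/
structure IsNullHeight (u : E → ℝ) : Prop where
  exists_unit_subgrad : ∀ x, ∃ e : E, ‖e‖ = 1 ∧ IsSubgrad u x e
  coercive : ∃ (m : E) (c : ℝ), ‖m‖ < 1 ∧ ∀ y, ⟪m, y⟫ + c ≤ u y

/-- The points `z` such that the segment from `(z, u z)` to `(x, u x)` is null (or trivial); it then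
lies on the graph of `u`. -/
def nullPast (u : E → ℝ) (x : E) : Set E := {z | u x - u z = ‖x - z‖}

/-- The length, measured in the domain of `u`, of the longest null segment of the graph of `u`
ending over `x`. -/
noncomputable def nullLength (u : E → ℝ) (x : E) : ℝ := sSup ((fun z => ‖x - z‖) '' nullPast u x)

theorem IsSubgrad.monotone {u : E → ℝ} {x y e e' : E} (h : IsSubgrad u x e)
    (h' : IsSubgrad u y e') : 0 ≤ ⟪x - y, e - e'⟫ := by
  have h1 := h y
  have h2 := h' x
  simp only [inner_sub_left, inner_sub_right, real_inner_comm] at *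
  linarith

/-- Moving along subgradients expands distances. -/
theorem IsSubgrad.norm_sub_le {u : E → ℝ} {x y e e' : E} (h : IsSubgrad u x e)
    (h' : IsSubgrad u y e') {t : ℝ} (ht : 0 ≤ t) :
    ‖x - y‖ ≤ ‖(x + t • e) - (y + t • e')‖ := by
  have h1 := h.monotone h'
  have h2 : (x + t • e) - (y + t • e') = (x - y) + t • (e - e') := by
    rw [smul_sub]; abel
  rw [h2]
  apply le_of_sq_le_sq _ (norm_nonneg _)
  rw [norm_add_sq_real, inner_smul_right]
  nlinarith [sq_nonneg ‖t • (e - e')‖, mul_nonneg ht h1]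

namespace IsNullHeight

variable {u : E → ℝ} (hu : IsNullHeight u)
include hu

theorem sub_le (x y : E) : u x - u y ≤ ‖x - y‖ := by
  obtain ⟨e, he, h⟩ := hu.exists_unit_subgrad x
  have h1 := h y
  have h2 := real_inner_le_norm e (x - y)
  rw [he, one_mul] at h2
  rw [← neg_sub x y, inner_neg_right] at h1
  linarith

theorem lipschitz : LipschitzWith 1 u := by
  refine LipschitzWith.of_dist_le_mul fun x y => ?_
  rw [Real.dist_eq, dist_eq_norm, NNReal.coe_one, one_mul, abs_le]
  have := hu.sub_le x y
  have h2 := hu.sub_le y x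
  rw [norm_sub_rev] at h2
  constructor <;> linarith

theorem continuous : Continuous u := hu.lipschitz.continuous

theorem norm_le_one_of_isSubgrad {x e : E} (h : IsSubgrad u x e) : ‖e‖ ≤ 1 := by
  have h1 := h (x + e)
  have h2 := hu.sub_le (x + e) x
  rw [add_sub_cancel_left] at h1 h2
  rw [real_inner_self_eq_norm_sq] at h1
  by_contra hc
  push Not at hc
  nlinarith

omit [InnerProductSpace ℝ E] hu in
theorem _root_.FlatSpacetime.self_mem_nullPast (x : E) : x ∈ nullPast u x := by simp [nullPast]

theorem eq_of_unit_subgrad {x e : E} (he : ‖e‖ = 1) (h : IsSubgrad u x e) {t : ℝ} (ht : 0 ≤ t) :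
    u (x + t • e) = u x + t := by
  have h1 := h (x + t • e)
  have h2 := hu.sub_le (x + t • e) x
  rw [add_sub_cancel_left] at h1 h2
  rw [inner_smul_right, real_inner_self_eq_norm_sq, he] at h1
  rw [norm_smul, he, Real.norm_of_nonneg ht] at h2
  linarith

/-- A unit subgradient is a subgradient all along the null ray it spans. -/
theorem isSubgrad_add_smul {x e : E} (he : ‖e‖ = 1) (h : IsSubgrad u x e) {t : ℝ} (ht : 0 ≤ t) :
    IsSubgrad u (x + t • e) e := by
  intro y
  rw [hu.eq_of_unit_subgrad he h ht]
  have h1 := h y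
  rw [← sub_sub, inner_sub_right, inner_smul_right, real_inner_self_eq_norm_sq, he]
  linarith

theorem mem_nullPast_add_smul {x e : E} (he : ‖e‖ = 1) (h : IsSubgrad u x e) {t : ℝ}
    (ht : 0 ≤ t) : x ∈ nullPast u (x + t • e) := by
  change u _ - u _ = _
  rw [hu.eq_of_unit_subgrad he h ht, add_sub_cancel_left, add_sub_cancel_left, norm_smul, he,
    Real.norm_of_nonneg ht, mul_one]

/-- Over the end of a null segment of the graph, the direction of the segment is the only
subgradient. -/
theorem eq_of_mem_nullPast {x z e : E} (hz : z ∈ nullPast u x) (h : IsSubgrad u x e) :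
    x - z = ‖x - z‖ • e := by
  have h1 := h z
  have hz' : u x - u z = ‖x - z‖ := hz
  have he := hu.norm_le_one_of_isSubgrad h
  rw [← neg_sub x z, inner_neg_right] at h1
  have h2 : ‖(x - z) - ‖x - z‖ • e‖ ^ 2 ≤ 0 := by
    rw [norm_sub_sq_real, inner_smul_right, real_inner_comm, norm_smul, norm_norm]
    have : ‖x - z‖ * ‖e‖ ≤ ‖x - z‖ := mul_le_of_le_one_right (norm_nonneg _) he
    nlinarith [norm_nonneg (x - z), norm_nonneg e, mul_nonneg (norm_nonneg (x - z)) (norm_nonneg e)]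
  have h3 : ‖(x - z) - ‖x - z‖ • e‖ = 0 := by nlinarith [norm_nonneg ((x - z) - ‖x - z‖ • e)]
  exact sub_eq_zero.1 (norm_eq_zero.1 h3)

theorem isSubgrad_of_mem_nullPast {x z e : E} (hz : z ∈ nullPast u x) (he : ‖e‖ = 1)
    (h : IsSubgrad u x e) {t : ℝ} (ht0 : 0 ≤ t) (ht : t ≤ ‖x - z‖) :
    u (x - t • e) = u x - t ∧ IsSubgrad u (x - t • e) e := by
  have h1 := hu.eq_of_mem_nullPast hz h
  have hz' : u x - u z = ‖x - z‖ := hz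
  have h2 : u (x - t • e) = u x - t := by
    have h3 := hu.sub_le x (x - t • e)
    have h4 := hu.sub_le (x - t • e) z
    have h5 : x - t • e - z = (‖x - z‖ - t) • e := by
      rw [sub_smul, ← h1]; abel
    rw [h5, norm_smul, he, Real.norm_of_nonneg (by linarith)] at h4
    rw [sub_sub_cancel, norm_smul, he, Real.norm_of_nonneg ht0] at h3
    linarith
  refine ⟨h2, fun y => ?_⟩
  have h6 := h y
  rw [h2, sub_sub_eq_add_sub, add_sub_right_comm, inner_add_right, inner_smul_right,
    real_inner_self_eq_norm_sq, he]
  linarith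

omit hu in
theorem one_sub_norm_mul_le_of_mem_nullPast {m : E} {c : ℝ} (hc : ∀ y, ⟪m, y⟫ + c ≤ u y) {x z : E}
    (hz : z ∈ nullPast u x) : (1 - ‖m‖) * ‖x - z‖ ≤ u x - ⟪m, x⟫ - c := by
  have h1 := hc z
  have hz' : u x - u z = ‖x - z‖ := hz
  have h2 := real_inner_le_norm m (x - z)
  rw [inner_sub_right] at h2
  linarith

/-- Null segments of the graph have at most linearly growing length. -/
theorem exists_norm_le_of_mem_nullPast :
    ∃ a b : ℝ, 0 ≤ a ∧ 0 ≤ b ∧ ∀ x, ∀ z ∈ nullPast u x, ‖x - z‖ ≤ a + b * ‖x‖ := by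
  obtain ⟨m, c, hm, hc⟩ := hu.coercive
  have hpos : 0 < 1 - ‖m‖ := by linarith
  refine ⟨(|u 0| + |c|) / (1 - ‖m‖), 2 / (1 - ‖m‖), by positivity, by positivity,
    fun x z hz => ?_⟩
  have h1 := one_sub_norm_mul_le_of_mem_nullPast hc hz
  have h2 := hu.sub_le x 0
  have h3 := neg_le_of_abs_le (abs_real_inner_le_norm m x)
  rw [sub_zero] at h2
  have h4 : ‖m‖ * ‖x‖ ≤ ‖x‖ := mul_le_of_le_one_left (norm_nonneg _) hm.le
  rw [div_mul_eq_mul_div, ← add_div, le_div_iff₀ hpos]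
  linarith [le_abs_self (u 0), neg_abs_le c]

theorem bddAbove_nullPast (x : E) : BddAbove ((fun z => ‖x - z‖) '' nullPast u x) := by
  obtain ⟨a, b, -, -, h⟩ := hu.exists_norm_le_of_mem_nullPast
  refine ⟨a + b * ‖x‖, ?_⟩
  rintro _ ⟨z, hz, rfl⟩
  exact h x z hz

theorem norm_sub_le_nullLength {x z : E} (hz : z ∈ nullPast u x) : ‖x - z‖ ≤ nullLength u x :=
  le_csSup (hu.bddAbove_nullPast x) ⟨z, hz, rfl⟩

theorem nullLength_nonneg (x : E) : 0 ≤ nullLength u x := by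
  simpa using hu.norm_sub_le_nullLength (self_mem_nullPast x)

theorem exists_nullLength_le :
    ∃ a b : ℝ, 0 ≤ a ∧ 0 ≤ b ∧ ∀ x, nullLength u x ≤ a + b * ‖x‖ := by
  obtain ⟨a, b, ha, hb, h⟩ := hu.exists_norm_le_of_mem_nullPast
  refine ⟨a, b, ha, hb, fun x => csSup_le ⟨_, x, self_mem_nullPast x, rfl⟩ ?_⟩
  rintro _ ⟨z, hz, rfl⟩
  exact h x z hz

theorem le_nullLength_add_smul {x e : E} (he : ‖e‖ = 1) (h : IsSubgrad u x e) {t : ℝ}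
    (ht : 0 ≤ t) : t ≤ nullLength u (x + t • e) := by
  have := hu.norm_sub_le_nullLength (hu.mem_nullPast_add_smul he h ht)
  rwa [add_sub_cancel_left, norm_smul, he, Real.norm_of_nonneg ht, mul_one] at this

section FiniteDimensional

variable [FiniteDimensional ℝ E]

theorem exists_mem_nullPast (x : E) : ∃ z ∈ nullPast u x, ‖x - z‖ = nullLength u x := by
  have hcl : IsClosed (nullPast u x) :=
    isClosed_eq (continuous_const.sub hu.continuous) (continuous_const.sub continuous_id).norm
  have hcpt : IsCompact (nullPast u x) := by
    apply Metric.isCompact_of_isClosed_isBounded hcl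
    obtain ⟨a, b, -, -, h⟩ := hu.exists_norm_le_of_mem_nullPast
    refine Metric.isBounded_closedBall.subset (t := Metric.closedBall x (a + b * ‖x‖)) ?_
    intro z hz
    rw [Metric.mem_closedBall, dist_comm, dist_eq_norm]
    exact h x z hz
  obtain ⟨z, hz, hz'⟩ := hcpt.exists_isMaxOn ⟨x, self_mem_nullPast x⟩
    (continuous_const.sub continuous_id : Continuous fun z => x - z).norm.continuousOn
  refine ⟨z, hz, le_antisymm (hu.norm_sub_le_nullLength hz) ?_⟩
  refine csSup_le ⟨_, x, self_mem_nullPast x, rfl⟩ ?_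
  rintro _ ⟨y, hy, rfl⟩
  exact hz' hy

theorem nullLength_eq_zero_of_isSubgrad {x e : E} (h : IsSubgrad u x e) (he : ‖e‖ < 1) :
    nullLength u x = 0 := by
  obtain ⟨z, hz, hz'⟩ := hu.exists_mem_nullPast x
  have h1 := hu.eq_of_mem_nullPast hz h
  have h2 : ‖x - z‖ = ‖x - z‖ * ‖e‖ := by
    conv_lhs => rw [h1, norm_smul, norm_norm]
  rw [← hz']
  nlinarith [norm_nonneg (x - z)]

/-- Going back a distance `t` along the null segment ending over `x` shortens it by `t`. -/
theorem exists_unit_subgrad_sub_smul (x : E) {t : ℝ} (ht0 : 0 ≤ t) (ht : t ≤ nullLength u x) :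
    ∃ e : E, ‖e‖ = 1 ∧ u (x - t • e) = u x - t ∧ IsSubgrad u (x - t • e) e ∧
      nullLength u x - t ≤ nullLength u (x - t • e) := by
  obtain ⟨z, hz, hz'⟩ := hu.exists_mem_nullPast x
  obtain ⟨e, he, h⟩ := hu.exists_unit_subgrad x
  have h0 := hu.isSubgrad_of_mem_nullPast hz he h ht0 (hz' ▸ ht)
  have h1 := hu.eq_of_mem_nullPast hz h
  have h5 : x - t • e - z = (‖x - z‖ - t) • e := by
    rw [sub_smul, ← h1]; abel
  have h6 : ‖x - t • e - z‖ = ‖x - z‖ - t := by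
    rw [h5, norm_smul, he, Real.norm_of_nonneg (by linarith), mul_one]
  refine ⟨e, he, h0.1, h0.2, ?_⟩
  rw [← hz', ← h6]
  apply hu.norm_sub_le_nullLength
  change u _ - u _ = _
  rw [h0.1, h6]
  have : u x - u z = ‖x - z‖ := hz
  linarith

/-- The null length does not increase faster than the distance along null rays of the graph, and the
same holds for its Lipschitz envelopes; this is the underlying comparison of two points. -/
theorem nullLength_le_or {x e x' : E} (h : IsSubgrad u x e) {t : ℝ} (ht : 0 ≤ t) :
    nullLength u x' ≤ t ∨ ∃ z, nullLength u x' - t ≤ nullLength u z ∧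
      ‖x - z‖ ≤ ‖x + t • e - x'‖ := by
  rcases le_total (nullLength u x') t with hle | hle
  · exact Or.inl hle
  · obtain ⟨e', he', -, h2, h3⟩ := hu.exists_unit_subgrad_sub_smul x' ht hle
    refine Or.inr ⟨_, h3, ?_⟩
    have := h.norm_sub_le h2 ht
    rwa [sub_add_cancel] at this

end FiniteDimensional

end IsNullHeight

/-! ### Gradients -/

section Gradient

variable [CompleteSpace E] {u : E → ℝ}

theorem gradient_eq_of_isSubgrad {x e : E} (hd : DifferentiableAt ℝ u x) (h : IsSubgrad u x e) :
    gradient u x = e := by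
  have hmin : IsLocalMin (fun y => u y - ⟪e, y⟫) x := by
    refine Filter.Eventually.of_forall fun y => ?_
    have := h y
    rw [inner_sub_right] at this
    simp only
    linarith
  have h1 : HasFDerivAt (fun y => u y - ⟪e, y⟫) (fderiv ℝ u x - innerSL ℝ e) x :=
    hd.hasFDerivAt.sub (innerSL ℝ e).hasFDerivAt
  have h2 := hmin.hasFDerivAt_eq_zero h1
  have h3 : fderiv ℝ u x = innerSL ℝ e := sub_eq_zero.1 h2
  rw [gradient, h3]
  exact (InnerProductSpace.toDual ℝ E).symm_apply_apply e

theorem IsNullHeight.gradient_spec (hu : IsNullHeight u) {x : E} (hd : DifferentiableAt ℝ u x) :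
    ‖gradient u x‖ = 1 ∧ IsSubgrad u x (gradient u x) := by
  obtain ⟨e, he, h⟩ := hu.exists_unit_subgrad x
  rw [gradient_eq_of_isSubgrad hd h]
  exact ⟨he, h⟩

/-- The gradient is constant along the null rays of the graph. -/
theorem IsNullHeight.gradient_add_smul (hu : IsNullHeight u) {x : E}
    (hd : DifferentiableAt ℝ u x) {t : ℝ} (ht : 0 ≤ t)
    (hd' : DifferentiableAt ℝ u (x + t • gradient u x)) :
    gradient u (x + t • gradient u x) = gradient u x :=
  gradient_eq_of_isSubgrad hd'
    (hu.isSubgrad_add_smul (hu.gradient_spec hd).1 (hu.gradient_spec hd).2 ht)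

end Gradient

end NullHeight

/-! ### Semicontinuity and stability of the null length -/

section Stability

variable {E : Type*} [NormedAddCommGroup E] [InnerProductSpace ℝ E]
  {u : E → ℝ} {uk : ℕ → E → ℝ}

theorem IsNullHeight.tendsto_apply (huk : ∀ k, IsNullHeight (uk k))
    (h : ∀ x, Tendsto (fun k => uk k x) atTop (𝓝 (u x))) {y : ℕ → E} {x : E}
    (hy : Tendsto y atTop (𝓝 x)) : Tendsto (fun k => uk k (y k)) atTop (𝓝 (u x)) := by
  have h1 : Tendsto (fun k => ‖y k - x‖) atTop (𝓝 0) := tendsto_iff_norm_sub_tendsto_zero.1 hy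
  have h2 : Tendsto (fun k => uk k (y k) - uk k x) atTop (𝓝 0) := by
    refine squeeze_zero_norm (fun k => ?_) h1
    simpa [dist_eq_norm] using (huk k).lipschitz.dist_le_mul (y k) x
  simpa using h2.add (h x)

variable [FiniteDimensional ℝ E]

/-- Upper semicontinuity of the null length jointly in the function and the point: null segments of
length `R` subconverge to null segments of length `R`. -/
theorem IsNullHeight.le_nullLength_of_frequently (hu : IsNullHeight u)
    (huk : ∀ k, IsNullHeight (uk k)) (h : ∀ x, Tendsto (fun k => uk k x) atTop (𝓝 (u x)))
    {y : ℕ → E} {x : E} (hy : Tendsto y atTop (𝓝 x)) {R : ℝ} (hR : 0 ≤ R)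
    (hf : ∃ᶠ k in atTop, R ≤ nullLength (uk k) (y k)) : R ≤ nullLength u x := by
  obtain ⟨φ, hφ, hφR⟩ := extraction_of_frequently_atTop hf
  choose e he heq _ _ using fun k => (huk (φ k)).exists_unit_subgrad_sub_smul _ hR (hφR k)
  obtain ⟨e', he', ψ, hψ, hlim⟩ := (isCompact_sphere (0 : E) 1).tendsto_subseq
    (x := e) (fun k => by simpa using he k)
  have he1 : ‖e'‖ = 1 := by simpa using he'
  have hsub : Tendsto (fun k => φ (ψ k)) atTop atTop := hφ.tendsto_atTop.comp hψ.tendsto_atTop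
  have hy' : Tendsto (fun k => y (φ (ψ k))) atTop (𝓝 x) := hy.comp hsub
  have h' : ∀ x, Tendsto (fun k => uk (φ (ψ k)) x) atTop (𝓝 (u x)) := fun x => (h x).comp hsub
  have h1 := IsNullHeight.tendsto_apply (fun k => huk (φ (ψ k))) h' hy'
  have h2 := IsNullHeight.tendsto_apply (fun k => huk (φ (ψ k))) h'
    (hy'.sub (hlim.const_smul R))
  have h3 : u (x - R • e') = u x - R := by
    refine tendsto_nhds_unique h2 ((h1.sub_const R).congr fun k => ?_)
    exact (heq (ψ k)).symm
  have h4 : x - R • e' ∈ nullPast u x := by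
    change u x - u _ = _
    rw [h3, sub_sub_cancel, sub_sub_cancel, norm_smul, he1, Real.norm_of_nonneg hR, mul_one]
  simpa [norm_smul, he1, abs_of_nonneg hR] using hu.norm_sub_le_nullLength h4

theorem IsNullHeight.upperSemicontinuous (hu : IsNullHeight u) :
    UpperSemicontinuous (nullLength u) := by
  intro x y hxy
  by_contra hc
  rw [Filter.not_eventually] at hc
  obtain ⟨z, hz, hzf⟩ := exists_seq_forall_of_frequently hc
  have := hu.le_nullLength_of_frequently (uk := fun _ => u) (fun _ => hu)
    (fun _ => tendsto_const_nhds) hz ((hu.nullLength_nonneg x).trans hxy.le)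
    (Frequently.of_forall fun k => not_lt.1 (hzf k))
  linarith

theorem IsNullHeight.measurable_nullLength [MeasurableSpace E] [BorelSpace E]
    (hu : IsNullHeight u) : Measurable (nullLength u) := hu.upperSemicontinuous.measurable

theorem IsNullHeight.eventually_nullLength_lt (hu : IsNullHeight u)
    (huk : ∀ k, IsNullHeight (uk k)) (h : ∀ x, Tendsto (fun k => uk k x) atTop (𝓝 (u x)))
    {x : E} {R : ℝ} (hR : nullLength u x < R) : ∀ᶠ k in atTop, nullLength (uk k) x < R := by
  by_contra hc
  rw [Filter.not_eventually] at hc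
  have := hu.le_nullLength_of_frequently huk h tendsto_const_nhds
    ((hu.nullLength_nonneg x).trans hR.le) (hc.mono fun k hk => not_lt.1 hk)
  linarith

theorem IsNullHeight.exists_eventually_nullLength_le (hu : IsNullHeight u)
    (huk : ∀ k, IsNullHeight (uk k)) (h : ∀ x, Tendsto (fun k => uk k x) atTop (𝓝 (u x)))
    {K : Set E} (hK : IsCompact K) :
    ∃ C, 0 ≤ C ∧ ∀ᶠ k in atTop, ∀ x ∈ K, nullLength (uk k) x ≤ C := by
  obtain ⟨a, b, ha, hb, hab⟩ := hu.exists_nullLength_le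
  obtain ⟨r, hr0, hr⟩ := hK.isBounded.exists_pos_norm_le
  have hle : ∀ x ∈ K, nullLength u x ≤ a + b * r := fun x hx =>
    (hab x).trans (by gcongr; exact hr x hx)
  refine ⟨a + b * r + 1, by positivity, ?_⟩
  by_contra hc
  rw [Filter.not_eventually] at hc
  obtain ⟨φ, hφ, hφR⟩ := extraction_of_frequently_atTop hc
  push Not at hφR
  choose y hyK hy using hφR
  obtain ⟨x, hx, ψ, hψ, hlim⟩ := hK.tendsto_subseq hyK
  have hsub : Tendsto (fun k => φ (ψ k)) atTop atTop := hφ.tendsto_atTop.comp hψ.tendsto_atTop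
  have := hu.le_nullLength_of_frequently (fun k => huk (φ (ψ k)))
    (fun x => (h x).comp hsub) hlim (by positivity)
    (Frequently.of_forall fun k => (hy (ψ k)).le)
  linarith [hle x hx]

theorem IsNullHeight.tendsto_gradient
    (huk : ∀ k, IsNullHeight (uk k)) (h : ∀ x, Tendsto (fun k => uk k x) atTop (𝓝 (u x)))
    {x : E} (hd : DifferentiableAt ℝ u x) (hdk : ∀ k, DifferentiableAt ℝ (uk k) x) :
    Tendsto (fun k => gradient (uk k) x) atTop (𝓝 (gradient u x)) := by
  refine tendsto_of_subseq_tendsto fun ns hns => ?_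
  obtain ⟨e, -, ψ, hψ, hlim⟩ := (isCompact_sphere (0 : E) 1).tendsto_subseq
    (x := fun k => gradient (uk (ns k)) x)
    (fun k => by simpa using ((huk (ns k)).gradient_spec (hdk _)).1)
  refine ⟨ψ, ?_⟩
  have hsub : Tendsto (fun k => ns (ψ k)) atTop atTop := hns.comp hψ.tendsto_atTop
  have he : IsSubgrad u x e := fun y => by
    refine le_of_tendsto_of_tendsto' (((h x).comp hsub).add
      (hlim.inner (tendsto_const_nhds (x := y - x)))) ((h y).comp hsub) fun k => ?_
    exact ((huk (ns (ψ k))).gradient_spec (hdk _)).2 y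
  rw [gradient_eq_of_isSubgrad hd he]
  exact hlim

end Stability

/-! ### Lipschitz envelopes of the null length -/

section Envelope

variable {E : Type*} [NormedAddCommGroup E] {u : E → ℝ}

/-- The smallest `L`-Lipschitz function above the null length. -/
noncomputable def nullEnvelope (u : E → ℝ) (L : ℝ) (x : E) : ℝ :=
  ⨆ z, (nullLength u z - L * ‖x - z‖)

variable {a b L : ℝ}

theorem nullLength_sub_le (hab : ∀ x, nullLength u x ≤ a + b * ‖x‖) (hb : 0 ≤ b) (hL : b ≤ L)
    (x z : E) : nullLength u z - L * ‖x - z‖ ≤ a + b * ‖x‖ := by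
  have h1 := hab z
  have h2 : ‖z‖ ≤ ‖x‖ + ‖x - z‖ := norm_le_norm_add_norm_sub x z
  have h3 := mul_le_mul_of_nonneg_left h2 hb
  have h4 := mul_le_mul_of_nonneg_right hL (norm_nonneg (x - z))
  linarith

theorem bddAbove_nullEnvelope (hab : ∀ x, nullLength u x ≤ a + b * ‖x‖) (hb : 0 ≤ b)
    (hL : b ≤ L) (x : E) : BddAbove (range fun z => nullLength u z - L * ‖x - z‖) := by
  refine ⟨a + b * ‖x‖, ?_⟩
  rintro _ ⟨z, rfl⟩
  exact nullLength_sub_le hab hb hL x z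

theorem nullEnvelope_le (hab : ∀ x, nullLength u x ≤ a + b * ‖x‖) (hb : 0 ≤ b)
    (hL : b ≤ L) (x : E) : nullEnvelope u L x ≤ a + b * ‖x‖ :=
  ciSup_le fun z => nullLength_sub_le hab hb hL x z

theorem nullLength_le_nullEnvelope (hab : ∀ x, nullLength u x ≤ a + b * ‖x‖) (hb : 0 ≤ b)
    (hL : b ≤ L) (x : E) : nullLength u x ≤ nullEnvelope u L x := by
  simpa [nullEnvelope] using le_ciSup (bddAbove_nullEnvelope hab hb hL x) x

theorem nullEnvelope_sub_le (hab : ∀ x, nullLength u x ≤ a + b * ‖x‖) (hb : 0 ≤ b)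
    (hL : b ≤ L) (x y : E) : nullEnvelope u L x ≤ nullEnvelope u L y + L * ‖x - y‖ := by
  refine ciSup_le fun z => ?_
  have h1 := le_ciSup (bddAbove_nullEnvelope hab hb hL y) z
  have h2 : ‖y - z‖ ≤ ‖x - y‖ + ‖x - z‖ := by
    rw [norm_sub_rev x y]; exact norm_sub_le_norm_sub_add_norm_sub y x z
  have h3 := mul_le_mul_of_nonneg_left h2 (hb.trans hL)
  change _ ≤ nullEnvelope u L y at h1
  linarith

theorem lipschitzWith_nullEnvelope (hab : ∀ x, nullLength u x ≤ a + b * ‖x‖) (hb : 0 ≤ b)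
    (hL : b ≤ L) : LipschitzWith L.toNNReal (nullEnvelope u L) := by
  refine LipschitzWith.of_dist_le_mul fun x y => ?_
  rw [Real.dist_eq, dist_eq_norm, Real.coe_toNNReal _ (hb.trans hL), abs_le]
  have h1 := nullEnvelope_sub_le hab hb hL x y
  have h2 := nullEnvelope_sub_le hab hb hL y x
  rw [norm_sub_rev] at h2
  constructor <;> linarith

variable [InnerProductSpace ℝ E] [FiniteDimensional ℝ E]

/-- The envelopes grow with slope at most one along null rays. Flowing along the rays expands
distances, so a competitor for the envelope at the later point can be moved back to a competitor at
the earlier point. -/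
theorem IsNullHeight.nullEnvelope_add_smul_le (hu : IsNullHeight u)
    (hab : ∀ x, nullLength u x ≤ a + b * ‖x‖) (hb : 0 ≤ b) (hL : b ≤ L) {x e : E}
    (h : IsSubgrad u x e) {t : ℝ} (ht : 0 ≤ t) :
    nullEnvelope u L (x + t • e) ≤ nullEnvelope u L x + t := by
  have hL0 := hb.trans hL
  refine ciSup_le fun z' => ?_
  rcases hu.nullLength_le_or (x' := z') h ht with hle | ⟨z, hz, hzn⟩
  · have h1 := nullLength_le_nullEnvelope hab hb hL x
    have h2 := hu.nullLength_nonneg x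
    have h3 := mul_nonneg hL0 (norm_nonneg (x + t • e - z'))
    linarith
  · have h1 : _ ≤ nullEnvelope u L x := le_ciSup (bddAbove_nullEnvelope hab hb hL x) z
    have h3 := mul_le_mul_of_nonneg_left hzn hL0
    linarith

theorem IsNullHeight.tendsto_nullEnvelope (hu : IsNullHeight u)
    (hab : ∀ x, nullLength u x ≤ a + b * ‖x‖) (hb : 0 ≤ b) (x : E) :
    Tendsto (fun N : ℕ => nullEnvelope u (N + b) x) atTop (𝓝 (nullLength u x)) := by
  have hL : ∀ N : ℕ, b ≤ N + b := fun N => by linarith [N.cast_nonneg (α := ℝ)]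
  refine tendsto_order.2 ⟨fun c hc => Eventually.of_forall fun N =>
    hc.trans_le (nullLength_le_nullEnvelope hab hb (hL N) x), fun c hc => ?_⟩
  obtain ⟨c', hc1, hc2⟩ := exists_between hc
  obtain ⟨r, hr, hball⟩ := Metric.eventually_nhds_iff.1 (hu.upperSemicontinuous x c' hc1)
  have hev : ∀ᶠ N : ℕ in atTop, (a + b * ‖x‖) / r ≤ N :=
    tendsto_natCast_atTop_atTop.eventually_ge_atTop _
  filter_upwards [hev] with N hN
  rw [div_le_iff₀ hr] at hN
  refine (ciSup_le fun z => ?_ : nullEnvelope u (N + b) x ≤ c').trans_lt hc2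
  have hpos : 0 ≤ (N + b : ℝ) * ‖x - z‖ := mul_nonneg (hb.trans (hL N)) (norm_nonneg _)
  rcases lt_or_ge (dist z x) r with hz | hz
  · have := hball hz
    linarith
  · rw [dist_comm, dist_eq_norm] at hz
    have h1 := hab z
    have h2 : ‖z‖ ≤ ‖x‖ + ‖x - z‖ := norm_le_norm_add_norm_sub x z
    have h3 := mul_le_mul_of_nonneg_left h2 hb
    have h4 := mul_le_mul_of_nonneg_left hz (N.cast_nonneg (α := ℝ))
    have h5 := hu.nullLength_nonneg x
    linarith

end Envelope

/-! ### Integration by parts against Lipschitz functions -/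

section Mollification

open scoped Convolution

variable {E : Type*} [NormedAddCommGroup E] [InnerProductSpace ℝ E] [FiniteDimensional ℝ E]
  [MeasurableSpace E] [BorelSpace E]

/-- Bump functions shrinking to the origin. -/
noncomputable def shrinkingBump (j : ℕ) : ContDiffBump (0 : E) where
  rIn := 1 / (2 * ((j : ℝ) + 1))
  rOut := 1 / ((j : ℝ) + 1)
  rIn_pos := by positivity
  rIn_lt_rOut := by
    apply one_div_lt_one_div_of_lt <;> linarith [j.cast_nonneg (α := ℝ)]

/-- Mollification of `F` at the scale `1 / (j + 1)`. -/
noncomputable def mollify (j : ℕ) (F : E → ℝ) : E → ℝ :=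
  ((shrinkingBump (E := E) j).normed volume ⋆[ContinuousLinearMap.lsmul ℝ ℝ, volume] F)

theorem mollify_apply (j : ℕ) (F : E → ℝ) (x : E) :
    mollify j F x = ∫ y, (shrinkingBump (E := E) j).normed volume y * F (x - y) := rfl

omit [InnerProductSpace ℝ E] [FiniteDimensional ℝ E] [MeasurableSpace E] [BorelSpace E] in
theorem tendsto_shrinkingBump_rOut :
    Tendsto (fun j => (shrinkingBump (E := E) j).rOut) atTop (𝓝 0) :=
  tendsto_one_div_add_atTop_nhds_zero_nat

theorem abs_mollify_le {F : E → ℝ} {M : ℝ} (hM : ∀ x, |F x| ≤ M) (j : ℕ) (x : E) :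
    |mollify j F x| ≤ M := by
  set φ := shrinkingBump (E := E) j
  have h1 : ‖∫ y, φ.normed volume y * F (x - y)‖ ≤ ∫ y, φ.normed volume y * M := by
    refine norm_integral_le_of_norm_le (φ.integrable_normed.mul_const M)
      (Eventually.of_forall fun y => ?_)
    rw [norm_mul, Real.norm_of_nonneg (φ.nonneg_normed y)]
    exact mul_le_mul_of_nonneg_left (hM _) (φ.nonneg_normed y)
  rwa [integral_mul_const, φ.integral_normed, one_mul] at h1

theorem mollify_eq_zero {F : E → ℝ} {R : ℝ} (hF : ∀ x, R ≤ ‖x‖ → F x = 0) (j : ℕ) {x : E}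
    (hx : R + 1 ≤ ‖x‖) : mollify j F x = 0 := by
  rw [mollify_apply]
  refine integral_eq_zero_of_ae (Eventually.of_forall fun y => ?_)
  by_cases hy : y ∈ Metric.ball (0 : E) (shrinkingBump (E := E) j).rOut
  · have h1 : ‖y‖ ≤ 1 := by
      rw [mem_ball_zero_iff] at hy
      refine hy.le.trans ?_
      change 1 / ((j : ℝ) + 1) ≤ 1
      rw [div_le_one (by positivity)]
      linarith [j.cast_nonneg (α := ℝ)]
    have h2 : R ≤ ‖x - y‖ := by linarith [norm_le_norm_add_norm_sub' x y]
    simp [hF _ h2]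
  · have : (shrinkingBump (E := E) j).normed volume y = 0 := by
      rw [← (shrinkingBump (E := E) j).support_normed_eq (μ := volume)] at hy
      exact Function.notMem_support.1 hy
    simp [this]

theorem contDiff_mollify {F : E → ℝ} (hF : LocallyIntegrable F) (j : ℕ) :
    ContDiff ℝ ∞ (mollify j F) :=
  (shrinkingBump (E := E) j).hasCompactSupport_normed.contDiff_convolution_left _
    (shrinkingBump (E := E) j).contDiff_normed hF

theorem tendsto_mollify {F : E → ℝ} (hF : Continuous F) (x : E) :
    Tendsto (fun j => mollify j F x) atTop (𝓝 (F x)) :=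
  ContDiffBump.convolution_tendsto_right_of_continuous tendsto_shrinkingBump_rOut hF x

theorem ae_tendsto_mollify {F : E → ℝ} (hF : LocallyIntegrable F) :
    ∀ᵐ x, Tendsto (fun j => mollify j F x) atTop (𝓝 (F x)) := by
  refine ContDiffBump.ae_convolution_tendsto_right_of_locallyIntegrable (K := 2)
    tendsto_shrinkingBump_rOut (Eventually.of_forall fun j => le_of_eq ?_) hF
  change 1 / ((j : ℝ) + 1) = 2 * (1 / (2 * ((j : ℝ) + 1)))
  field_simp

/-- Mollification commutes with directional derivatives of Lipschitz functions. -/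
theorem fderiv_mollify {F : E → ℝ} {D : ℝ≥0} (hF : LipschitzWith D F) (j : ℕ) (x v : E) :
    fderiv ℝ (mollify j F) x v = mollify j (fun y => lineDeriv ℝ F y v) x := by
  set φ := shrinkingBump (E := E) j
  have hloc : LocallyIntegrable F := hF.continuous.locallyIntegrable
  have hd : DifferentiableAt ℝ (mollify j F) x :=
    (contDiff_mollify hloc j).differentiable (by simp) x
  rw [← hd.lineDeriv_eq_fderiv]
  refine HasDerivAt.deriv (f := fun t : ℝ => mollify j F (x + t • v)) ?_
  have hcont : ∀ t : ℝ, Continuous fun y => φ.normed volume y * F (x + t • v - y) := fun t =>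
    φ.continuous_normed.mul (hF.continuous.comp (continuous_const.sub continuous_id))
  refine (hasDerivAt_integral_of_dominated_loc_of_lip (μ := volume) (s := univ)
    (F := fun (t : ℝ) y => φ.normed volume y * F (x + t • v - y))
    (F' := fun y => φ.normed volume y * lineDeriv ℝ F (x - y) v)
    (bound := fun y => φ.normed volume y * (D * ‖v‖)) univ_mem
    (Eventually.of_forall fun t => (hcont t).aestronglyMeasurable)
    ((hcont 0).integrable_of_hasCompactSupport φ.hasCompactSupport_normed.mul_right) ?_ ?_
    (φ.integrable_normed.mul_const _) ?_).2
  · exact (φ.continuous_normed.measurable.mul ((measurable_lineDeriv hF.continuous).comp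
      (measurable_const.sub measurable_id))).aestronglyMeasurable
  · refine Eventually.of_forall fun y => ?_
    refine LipschitzWith.lipschitzOnWith ?_
    refine LipschitzWith.of_dist_le_mul fun s t => ?_
    have h1 := hF.dist_le_mul (x + s • v - y) (x + t • v - y)
    rw [dist_eq_norm, dist_eq_norm] at h1 ⊢
    have h2 : x + s • v - y - (x + t • v - y) = (s - t) • v := by rw [sub_smul]; abel
    rw [h2, norm_smul] at h1
    have hb : 0 ≤ φ.normed volume y * (D * ‖v‖) :=
      mul_nonneg (φ.nonneg_normed y) (by positivity)
    rw [← mul_sub, norm_mul, Real.norm_of_nonneg (φ.nonneg_normed y), Real.coe_nnabs,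
      abs_of_nonneg hb, mul_assoc]
    refine mul_le_mul_of_nonneg_left (h1.trans (le_of_eq ?_)) (φ.nonneg_normed y)
    ring
  · have h1 : ∀ᵐ y, DifferentiableAt ℝ F (x - y) :=
      (quasiMeasurePreserving_sub_left volume x).ae hF.ae_differentiableAt
    filter_upwards [h1] with y hy
    have h2 := hy.hasFDerivAt.hasLineDerivAt v
    rw [hy.lineDeriv_eq_fderiv]
    have h3 : HasDerivAt (fun t : ℝ => F (x - y + t • v)) (fderiv ℝ F (x - y) v) 0 := h2
    refine HasDerivAt.const_mul _ (h3.congr_of_eventuallyEq (Eventually.of_forall fun t => ?_))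
    change F _ = F _
    congr 1
    abel

open Laplacian in
theorem integral_mul_laplacian {u f : E → ℝ} {C : ℝ≥0} (hu : LipschitzWith C u)
    (hf : ContDiff ℝ ∞ f) (hfc : HasCompactSupport f) :
    ∫ x, u x * laplacian f x = -∑ i, ∫ x, lineDeriv ℝ u x (stdOrthonormalBasis ℝ E i) *
      fderiv ℝ f x (stdOrthonormalBasis ℝ E i) := by
  set b := stdOrthonormalBasis ℝ E
  have hd1 : ContDiff ℝ ∞ (fderiv ℝ f) := hf.fderiv_right (by simp)
  have hg : ∀ v, ContDiff ℝ ∞ fun y => fderiv ℝ f y v := fun v => hd1.clm_apply contDiff_const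
  have hgc : ∀ v, HasCompactSupport fun y => fderiv ℝ f y v := fun v =>
    (hfc.fderiv ℝ).comp_left (g := fun l : E →L[ℝ] ℝ => l v) rfl
  have hlap : ∀ x, laplacian f x =
      ∑ i, lineDeriv ℝ (fun y => fderiv ℝ f y (b i)) x (b i) := by
    intro x
    have h0 := congrFun (InnerProductSpace.laplacian_eq_iteratedFDeriv_stdOrthonormalBasis f) x
    refine h0.trans (Finset.sum_congr rfl fun i _ => ?_)
    have hdx : DifferentiableAt ℝ (fderiv ℝ f) x := hd1.differentiable (by simp) x
    rw [iteratedFDeriv_two_apply, ((hg (b i)).differentiable (by simp) x).lineDeriv_eq_fderiv,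
      fderiv_clm_apply hdx (by fun_prop)]
    simp [b]
  have hparts : ∀ v, ∫ x, u x * lineDeriv ℝ (fun y => fderiv ℝ f y v) x v =
      -∫ x, lineDeriv ℝ u x v * fderiv ℝ f x v := by
    intro v
    obtain ⟨D, hD⟩ := (hg v).lipschitzWith_of_hasCompactSupport (hgc v) (by simp)
    rw [hu.integral_lineDeriv_mul_eq hD (hgc v), ← integral_neg]
    refine integral_congr_ae (Eventually.of_forall fun x => ?_)
    simp only [lineDeriv_neg]
    ring
  simp_rw [hlap, Finset.mul_sum]
  rw [integral_finsetSum, ← Finset.sum_neg_distrib]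
  · exact Finset.sum_congr rfl fun i _ => hparts (b i)
  · intro i _
    have h1 : ∀ x, lineDeriv ℝ (fun y => fderiv ℝ f y (b i)) x (b i) =
        fderiv ℝ (fun y => fderiv ℝ f y (b i)) x (b i) := fun x =>
      ((hg (b i)).differentiable (by simp) x).lineDeriv_eq_fderiv
    simp_rw [h1]
    refine (hu.continuous.mul ?_).integrable_of_hasCompactSupport ?_
    · exact ((hg (b i)).continuous_fderiv (by simp)).clm_apply continuous_const
    · exact (((hgc (b i)).fderiv ℝ).comp_left (g := fun l : E →L[ℝ] ℝ => l (b i)) rfl).mul_left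

/-- If `μ` is the distributional Laplacian of a Lipschitz function `u`, then the weak form of the
Laplace equation extends from smooth to Lipschitz test functions. -/
theorem integral_eq_neg_integral_inner_gradient {u F : E → ℝ} {C D : ℝ≥0} {μ : Measure E}
    [IsLocallyFiniteMeasure μ] (hu : LipschitzWith C u)
    (hμ : ∀ f : E → ℝ, ContDiff ℝ ∞ f → HasCompactSupport f →
      ∫ x, u x * Laplacian.laplacian f x = ∫ x, f x ∂μ)
    (hF : LipschitzWith D F) (hFc : HasCompactSupport F) :
    ∫ x, F x ∂μ = -∫ x, ⟪gradient u x, gradient F x⟫ := by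
  set b := stdOrthonormalBasis ℝ E
  obtain ⟨R, hR⟩ : ∃ R, ∀ x, R ≤ ‖x‖ → F x = 0 := by
    obtain ⟨R, -, hR⟩ := hFc.exists_pos_le_norm
    exact ⟨R, hR⟩
  obtain ⟨M, hM⟩ : ∃ M, ∀ x, |F x| ≤ M := by
    obtain ⟨M, hM⟩ := hF.continuous.bounded_above_of_compact_support hFc
    exact ⟨M, hM⟩
  have hloc : LocallyIntegrable F := hF.continuous.locallyIntegrable
  have hball : ∀ x, x ∉ Metric.closedBall (0 : E) (R + 1) → R + 1 ≤ ‖x‖ := fun x hx => by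
    rw [mem_closedBall_zero_iff, not_le] at hx
    exact hx.le
  have hsupp : ∀ j, HasCompactSupport (mollify j F) := fun j =>
    HasCompactSupport.intro (isCompact_closedBall 0 (R + 1)) fun x hx =>
      mollify_eq_zero hR j (hball x hx)
  -- both sides of the identity for the mollified function converge
  have hlim1 : Tendsto (fun j => ∫ x, mollify j F x ∂μ) atTop (𝓝 (∫ x, F x ∂μ)) := by
    refine tendsto_integral_of_dominated_convergence
      ((Metric.closedBall (0 : E) (R + 1)).indicator fun _ => M)
      (fun j => (contDiff_mollify hloc j).continuous.aestronglyMeasurable) ?_ ?_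
      (Eventually.of_forall fun x => tendsto_mollify hF.continuous x)
    · exact (integrable_indicator_iff measurableSet_closedBall).2
        (integrableOn_const (isCompact_closedBall _ _).measure_lt_top.ne)
    · refine fun j => Eventually.of_forall fun x => ?_
      by_cases hx : x ∈ Metric.closedBall (0 : E) (R + 1)
      · rw [indicator_of_mem hx]
        exact abs_mollify_le hM j x
      · rw [indicator_of_notMem hx, mollify_eq_zero hR j (hball x hx), norm_zero]
  have hz : ∀ v x, R + 1 ≤ ‖x‖ → lineDeriv ℝ F x v = 0 := by
    intro v x hx
    have h0 : F =ᶠ[𝓝 x] fun _ => 0 := by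
      filter_upwards [(isOpen_lt continuous_const continuous_norm).mem_nhds
        (show R < ‖x‖ by linarith)] with y hy
      exact hR y (le_of_lt hy)
    rw [h0.lineDeriv_eq]
    simp [lineDeriv]
  have hlim2 : ∀ v, Tendsto (fun j => ∫ x, lineDeriv ℝ u x v * fderiv ℝ (mollify j F) x v) atTop
      (𝓝 (∫ x, lineDeriv ℝ u x v * lineDeriv ℝ F x v)) := by
    intro v
    have hbd : ∀ x, |lineDeriv ℝ F x v| ≤ D * ‖v‖ := fun x => norm_lineDeriv_le_of_lipschitz ℝ hF
    refine tendsto_integral_of_dominated_convergence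
      ((Metric.closedBall (0 : E) (R + 1 + 1)).indicator fun _ => (C * ‖v‖) * (D * ‖v‖))
      (fun j => ?_) ?_ ?_ ?_
    · exact ((measurable_lineDeriv hu.continuous).mul
        (measurable_fderiv_apply_const ℝ _ v)).aestronglyMeasurable
    · exact (integrable_indicator_iff measurableSet_closedBall).2
        (integrableOn_const (isCompact_closedBall _ _).measure_lt_top.ne)
    · refine fun j => Eventually.of_forall fun x => ?_
      rw [fderiv_mollify hF]
      by_cases hx : x ∈ Metric.closedBall (0 : E) (R + 1 + 1)
      · rw [indicator_of_mem hx, norm_mul]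
        exact mul_le_mul (norm_lineDeriv_le_of_lipschitz ℝ hu) (abs_mollify_le hbd j x)
          (norm_nonneg _) (by positivity)
      · rw [mem_closedBall_zero_iff, not_le] at hx
        rw [mollify_eq_zero (hz v) j hx.le, mul_zero, norm_zero]
        exact indicator_nonneg (fun _ _ => by positivity) _
    · filter_upwards [ae_tendsto_mollify (hF.locallyIntegrable_lineDeriv v)] with x hx
      simp_rw [fderiv_mollify hF]
      exact hx.const_mul _
  have heq : ∀ j, ∫ x, mollify j F x ∂μ =
      -∑ i, ∫ x, lineDeriv ℝ u x (b i) * fderiv ℝ (mollify j F) x (b i) := fun j => by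
    rw [← hμ _ (contDiff_mollify hloc j) (hsupp j),
      integral_mul_laplacian hu (contDiff_mollify hloc j) (hsupp j)]
  have h1 : ∫ x, F x ∂μ = -∑ i, ∫ x, lineDeriv ℝ u x (b i) * lineDeriv ℝ F x (b i) := by
    refine tendsto_nhds_unique hlim1 ?_
    simp_rw [heq]
    exact (tendsto_finsetSum _ fun i _ => hlim2 (b i)).neg
  rw [h1, ← integral_finsetSum]
  · congr 1
    refine integral_congr_ae ?_
    filter_upwards [hu.ae_differentiableAt, hF.ae_differentiableAt] with x hx hx'
    rw [← b.sum_inner_mul_inner]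
    refine Finset.sum_congr rfl fun i _ => ?_
    rw [hx.lineDeriv_eq_fderiv, hx'.lineDeriv_eq_fderiv, ← inner_gradient_left,
      ← inner_gradient_left, real_inner_comm (b i) (gradient F x)]
  · intro i _
    have h2 : Integrable ((Metric.closedBall (0 : E) (R + 1)).indicator
        fun _ => (C * ‖b i‖) * (D * ‖b i‖) : E → ℝ) :=
      (integrable_indicator_iff measurableSet_closedBall).2
        (integrableOn_const (isCompact_closedBall _ _).measure_lt_top.ne)
    refine h2.mono' ((measurable_lineDeriv hu.continuous).mul
        (measurable_lineDeriv hF.continuous)).aestronglyMeasurable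
        (Eventually.of_forall fun x => ?_)
    by_cases hx : x ∈ Metric.closedBall (0 : E) (R + 1)
    · rw [indicator_of_mem hx, norm_mul]
      exact mul_le_mul (norm_lineDeriv_le_of_lipschitz ℝ hu) (norm_lineDeriv_le_of_lipschitz ℝ hF)
        (norm_nonneg _) (by positivity)
    · rw [hz _ x (hball x hx), mul_zero, norm_zero]
      exact indicator_nonneg (fun _ _ => by positivity) _

end Mollification

/-! ### Test functions adapted to a height function -/

section General

theorem hasDerivAt_max_zero_sq (t : ℝ) :
    HasDerivAt (fun s : ℝ => max s 0 ^ 2) (2 * max t 0) t := by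
  rcases lt_trichotomy t 0 with ht | rfl | ht
  · rw [max_eq_right ht.le, mul_zero]
    refine (hasDerivAt_const t (0 : ℝ)).congr_of_eventuallyEq ?_
    filter_upwards [Iio_mem_nhds ht] with s hs
    simp [max_eq_right (le_of_lt (mem_Iio.1 hs))]
  · rw [max_self, mul_zero, hasDerivAt_iff_tendsto]
    have h1 : Tendsto (fun s : ℝ => |s|) (𝓝 0) (𝓝 0) := by
      simpa using continuous_abs.tendsto (0 : ℝ)
    refine squeeze_zero (fun s => by positivity) (fun s => ?_) h1
    rcases eq_or_ne s 0 with rfl | hs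
    · simp
    · have h2 : 0 < |s| := abs_pos.2 hs
      have h3 : max s 0 ≤ |s| := max_le (le_abs_self s) (abs_nonneg s)
      have h4 : 0 ≤ max s 0 := le_max_right _ _
      simp only [sub_zero, max_self, ne_eq, OfNat.ofNat_ne_zero, not_false_eq_true, zero_pow,
        smul_zero, Real.norm_eq_abs, abs_pow, abs_of_nonneg h4]
      rw [inv_mul_le_iff₀ h2]
      nlinarith
  · rw [max_eq_left ht.le]
    have h1 : HasDerivAt (fun s : ℝ => s ^ 2) (2 * t) t := by simpa using hasDerivAt_pow 2 t
    refine h1.congr_of_eventuallyEq ?_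
    filter_upwards [Ioi_mem_nhds ht] with s hs
    rw [max_eq_left (le_of_lt (mem_Ioi.1 hs))]

variable {E : Type*} [NormedAddCommGroup E]

theorem exists_lipschitzWith_mul [ProperSpace E] {f g : E → ℝ} {A B : ℝ≥0} (hf : LipschitzWith A f)
    (hg : LipschitzWith B g) (hgc : HasCompactSupport g) :
    ∃ D, LipschitzWith D fun x => f x * g x := by
  obtain ⟨M₁, h₁⟩ := hgc.exists_bound_of_continuousOn hf.continuous.continuousOn
  obtain ⟨M₂, h₂⟩ := hg.continuous.bounded_above_of_compact_support hgc
  have hM₂ : 0 ≤ M₂ := (norm_nonneg _).trans (h₂ 0)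
  have key : ∀ x y, x ∈ tsupport g →
      |f x * g x - f y * g y| ≤ (|M₁| * B + A * M₂) * dist x y := by
    intro x y hx
    have e : f x * g x - f y * g y = f x * (g x - g y) + (f x - f y) * g y := by ring
    have h3 := hf.dist_le_mul x y
    have h4 := hg.dist_le_mul x y
    rw [Real.dist_eq] at h3 h4
    rw [e]
    refine (abs_add_le _ _).trans ?_
    rw [abs_mul, abs_mul, add_mul, mul_assoc, mul_right_comm]
    refine add_le_add ?_ ?_
    · exact mul_le_mul ((h₁ x hx).trans (le_abs_self _)) h4 (abs_nonneg _) (abs_nonneg _)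
    · exact mul_le_mul h3 (h₂ y) (abs_nonneg _) (by positivity)
  have hC : 0 ≤ |M₁| * B + A * M₂ := by positivity
  refine ⟨(|M₁| * B + A * M₂).toNNReal, LipschitzWith.of_dist_le_mul fun x y => ?_⟩
  rw [Real.coe_toNNReal _ hC, Real.dist_eq]
  by_cases hx : x ∈ tsupport g
  · exact key x y hx
  · by_cases hy : y ∈ tsupport g
    · rw [abs_sub_comm, dist_comm]
      exact key y x hy
    · rw [image_eq_zero_of_notMem_tsupport hx, image_eq_zero_of_notMem_tsupport hy]
      simp only [mul_zero, sub_self, abs_zero]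
      positivity

theorem integrable_of_le_of_eq_zero [ProperSpace E] [MeasurableSpace E] [BorelSpace E]
    {μ : Measure E} [IsLocallyFiniteMeasure μ] {h : E → ℝ} {r M : ℝ}
    (hm : AEStronglyMeasurable h μ) (hb : ∀ x, ‖x‖ ≤ r → |h x| ≤ M)
    (h0 : ∀ x, r < ‖x‖ → h x = 0) : Integrable h μ := by
  have h2 : Integrable ((Metric.closedBall (0 : E) r).indicator fun _ => M : E → ℝ) μ :=
    (integrable_indicator_iff measurableSet_closedBall).2
      (integrableOn_const (isCompact_closedBall _ _).measure_lt_top.ne)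
  refine h2.mono' hm (Eventually.of_forall fun x => ?_)
  by_cases hx : x ∈ Metric.closedBall (0 : E) r
  · rw [indicator_of_mem hx]
    exact hb x (mem_closedBall_zero_iff.1 hx)
  · rw [indicator_of_notMem hx, h0 x (not_le.1 fun h => hx (mem_closedBall_zero_iff.2 h)),
      norm_zero]

end General

section TestFunctions

variable {E : Type*} [NormedAddCommGroup E]

/-- The function `√(ε² + ‖x‖²)`, whose graph is a hyperboloid. -/
noncomputable def softNorm (ε : ℝ) (x : E) : ℝ := √(ε ^ 2 + ‖x‖ ^ 2)

theorem softNorm_sq (ε : ℝ) (x : E) : softNorm ε x ^ 2 = ε ^ 2 + ‖x‖ ^ 2 :=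
  Real.sq_sqrt (by positivity)

theorem softNorm_nonneg (ε : ℝ) (x : E) : 0 ≤ softNorm ε x := Real.sqrt_nonneg _

theorem softNorm_pos {ε : ℝ} (hε : 0 < ε) (x : E) : 0 < softNorm ε x :=
  Real.sqrt_pos.2 (by positivity)

theorem norm_lt_softNorm {ε : ℝ} (hε : 0 < ε) (x : E) : ‖x‖ < softNorm ε x :=
  Real.lt_sqrt_of_sq_lt (by nlinarith)

theorem continuous_softNorm (ε : ℝ) : Continuous (softNorm ε : E → ℝ) := by
  unfold softNorm; fun_prop

/-- The positive part of `R - (u + softNorm 1)`. -/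
noncomputable def testDepth (u : E → ℝ) (R : ℝ) (x : E) : ℝ := max (R - (u x + softNorm 1 x)) 0

/-- A compactly supported function decreasing along the null rays of the graph of `u`. -/
noncomputable def testFn (u : E → ℝ) (R : ℝ) (x : E) : ℝ := testDepth u R x ^ 2

theorem testDepth_nonneg (u : E → ℝ) (R : ℝ) (x : E) : 0 ≤ testDepth u R x := le_max_right _ _

theorem testFn_nonneg (u : E → ℝ) (R : ℝ) (x : E) : 0 ≤ testFn u R x := sq_nonneg _

theorem testDepth_eq_zero {u : E → ℝ} {R : ℝ} {x : E} (h : R ≤ u x + softNorm 1 x) :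
    testDepth u R x = 0 := max_eq_right (by linarith)

variable [InnerProductSpace ℝ E]

/-- The gradient of `softNorm ε`. -/
noncomputable def softGrad (ε : ℝ) (x : E) : E := (softNorm ε x)⁻¹ • x

/-- The rate of decrease of `testFn u R` along the null rays of the graph of `u`. -/
noncomputable def testWeight [CompleteSpace E] (u : E → ℝ) (R : ℝ) (x : E) : ℝ :=
  2 * testDepth u R x * (1 + ⟪gradient u x, softGrad 1 x⟫)

theorem norm_softGrad_lt_one {ε : ℝ} (hε : 0 < ε) (x : E) : ‖softGrad ε x‖ < 1 := by
  have h := softNorm_pos hε x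
  rw [softGrad, norm_smul, norm_inv, Real.norm_of_nonneg h.le, inv_mul_lt_iff₀ h, mul_one]
  exact norm_lt_softNorm hε x

theorem continuous_softGrad {ε : ℝ} (hε : 0 < ε) : Continuous (softGrad ε : E → E) :=
  ((continuous_softNorm ε).inv₀ fun x => (softNorm_pos hε x).ne').smul continuous_id

theorem hasFDerivAt_softNorm {ε : ℝ} (hε : 0 < ε) (x : E) :
    HasFDerivAt (softNorm ε) (innerSL ℝ (softGrad ε x)) x := by
  have h1 : HasFDerivAt (fun y : E => ε ^ 2 + ‖y‖ ^ 2) (2 • innerSL ℝ x) x :=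
    (hasStrictFDerivAt_norm_sq x).hasFDerivAt.const_add _
  have h2 := h1.sqrt (by positivity)
  refine h2.congr_fderiv ?_
  ext y
  have := (softNorm_pos hε x).ne'
  simp only [softNorm] at this
  simp [softGrad, softNorm]
  field_simp

theorem softNorm_add_inner_le {ε : ℝ} (hε : 0 < ε) (x y : E) :
    softNorm ε y + ⟪softGrad ε y, x - y⟫ ≤ softNorm ε x := by
  have hy := softNorm_pos hε y
  have hx := softNorm_pos hε x
  have hx2 := softNorm_sq ε x
  have hy2 := softNorm_sq ε y
  have h1 : softNorm ε y + ⟪softGrad ε y, x - y⟫ = (ε ^ 2 + ⟪y, x⟫) / softNorm ε y := by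
    rw [softGrad, real_inner_smul_left, inner_sub_right, real_inner_self_eq_norm_sq,
      show ‖y‖ ^ 2 = softNorm ε y ^ 2 - ε ^ 2 by linarith]
    field_simp
    ring
  rw [h1, div_le_iff₀ hy]
  have h2 := real_inner_le_norm y x
  refine le_trans (add_le_add_right h2 _) (le_of_sq_le_sq ?_ (by positivity))
  rw [mul_pow, hx2, hy2]
  nlinarith [mul_nonneg (sq_nonneg ε) (sq_nonneg (‖x‖ - ‖y‖))]

theorem lipschitzWith_softNorm {ε : ℝ} (hε : 0 < ε) : LipschitzWith 1 (softNorm ε : E → ℝ) := by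
  refine lipschitzWith_of_nnnorm_fderiv_le (𝕜 := ℝ)
    (fun x => (hasFDerivAt_softNorm hε x).differentiableAt) fun x => ?_
  rw [(hasFDerivAt_softNorm hε x).fderiv, ← NNReal.coe_le_coe, coe_nnnorm, innerSL_apply_norm]
  exact (norm_softGrad_lt_one hε x).le

theorem hasFDerivAt_testFn {u : E → ℝ} {R : ℝ} {x : E} {u' : E →L[ℝ] ℝ} (h : HasFDerivAt u u' x) :
    HasFDerivAt (testFn u R) (-(2 * testDepth u R x) • (u' + innerSL ℝ (softGrad 1 x))) x := by
  have h1 : HasFDerivAt (fun y => R - (u y + softNorm 1 y)) (-(u' + innerSL ℝ (softGrad 1 x))) x :=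
    (h.add (hasFDerivAt_softNorm one_pos x)).const_sub R
  refine ((hasDerivAt_max_zero_sq _).comp_hasFDerivAt x h1).congr_fderiv ?_
  ext y
  simp [testDepth]
  ring

namespace IsNullHeight

variable {u : E → ℝ} (hu : IsNullHeight u)
include hu

theorem exists_le_add_softNorm (R : ℝ) :
    ∃ r, 0 ≤ r ∧ ∀ x : E, r ≤ ‖x‖ → R ≤ u x + softNorm 1 x := by
  obtain ⟨m, c, hm, hc⟩ := hu.coercive
  have hpos : 0 < 1 - ‖m‖ := by linarith
  refine ⟨|R - c| / (1 - ‖m‖), by positivity, fun x hx => ?_⟩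
  rw [div_le_iff₀ hpos] at hx
  have h1 := hc x
  have h2 := norm_lt_softNorm one_pos x
  have h3 := neg_le_of_abs_le (abs_real_inner_le_norm m x)
  have h4 := le_abs_self (R - c)
  nlinarith

theorem continuous_testDepth (R : ℝ) : Continuous (testDepth u R) :=
  (continuous_const.sub (hu.continuous.add (continuous_softNorm 1))).max continuous_const

theorem continuous_testFn (R : ℝ) : Continuous (testFn u R) := (hu.continuous_testDepth R).pow 2

theorem lipschitzWith_testDepth (R : ℝ) : LipschitzWith 2 (testDepth u R) := by
  have h1 : LipschitzWith (0 + (1 + 1)) fun x => R - (u x + softNorm 1 x) :=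
    (LipschitzWith.const R).sub (hu.lipschitz.add (lipschitzWith_softNorm one_pos))
  have h2 := h1.max_const 0
  rw [zero_add, one_add_one_eq_two] at h2
  exact h2

variable [FiniteDimensional ℝ E]

theorem hasCompactSupport_testDepth (R : ℝ) : HasCompactSupport (testDepth u R) := by
  obtain ⟨r, -, hr⟩ := hu.exists_le_add_softNorm R
  refine HasCompactSupport.intro (isCompact_closedBall 0 r) fun x hx => ?_
  rw [mem_closedBall_zero_iff, not_le] at hx
  exact testDepth_eq_zero (hr x hx.le)

theorem exists_testDepth_le (R : ℝ) : ∃ M, 0 ≤ M ∧ ∀ x, testDepth u R x ≤ M := by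
  obtain ⟨M, hM⟩ := (hu.continuous_testDepth R).bounded_above_of_compact_support
    (hu.hasCompactSupport_testDepth R)
  exact ⟨M, (norm_nonneg _).trans (hM 0), fun x => (le_abs_self _).trans (hM x)⟩

theorem hasCompactSupport_testFn (R : ℝ) : HasCompactSupport (testFn u R) :=
  (hu.hasCompactSupport_testDepth R).comp_left (g := fun t => t ^ 2) (by simp)

theorem exists_lipschitzWith_testFn (R : ℝ) : ∃ D, LipschitzWith D (testFn u R) := by
  obtain ⟨D, hD⟩ := exists_lipschitzWith_mul (hu.lipschitzWith_testDepth R)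
    (hu.lipschitzWith_testDepth R) (hu.hasCompactSupport_testDepth R)
  refine ⟨D, ?_⟩
  convert hD using 2 with x
  exact sq _

theorem norm_gradient_le (x : E) : ‖gradient u x‖ ≤ 1 := by
  by_cases hd : DifferentiableAt ℝ u x
  · exact (hu.gradient_spec hd).1.le
  · simp [gradient_eq_zero_of_not_differentiableAt hd]

theorem one_sub_norm_softGrad_le (x : E) :
    1 - ‖softGrad 1 x‖ ≤ 1 + ⟪gradient u x, softGrad 1 x⟫ := by
  have h1 := neg_le_of_abs_le (abs_real_inner_le_norm (gradient u x) (softGrad 1 x))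
  have h2 := mul_le_of_le_one_left (norm_nonneg (softGrad 1 x)) (hu.norm_gradient_le x)
  linarith

theorem testWeight_nonneg (R : ℝ) (x : E) : 0 ≤ testWeight u R x := by
  have h1 := hu.one_sub_norm_softGrad_le x
  have h2 := norm_softGrad_lt_one one_pos x
  exact mul_nonneg (mul_nonneg two_pos.le (testDepth_nonneg u R x)) (by linarith)

theorem testWeight_le (R : ℝ) (x : E) : testWeight u R x ≤ 4 * testDepth u R x := by
  have h1 := real_inner_le_norm (gradient u x) (softGrad 1 x)
  have h2 := mul_le_of_le_one_left (norm_nonneg (softGrad 1 x)) (hu.norm_gradient_le x)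
  have h3 := norm_softGrad_lt_one one_pos x
  have h4 := testDepth_nonneg u R x
  unfold testWeight
  nlinarith

end IsNullHeight

variable [FiniteDimensional ℝ E] [MeasurableSpace E] [BorelSpace E]

theorem measurable_gradient (u : E → ℝ) : Measurable (gradient u) :=
  (InnerProductSpace.toDual ℝ E).symm.continuous.measurable.comp (measurable_fderiv ℝ u)

theorem IsNullHeight.measurable_testWeight {u : E → ℝ} (hu : IsNullHeight u) (R : ℝ) :
    Measurable (testWeight u R) :=
  ((hu.continuous_testDepth R).measurable.const_mul 2).mul
    (((measurable_gradient u).inner (continuous_softGrad one_pos).measurable).const_add 1)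

/-! ### The upper bound for the divergence of the null length -/

variable {u : E → ℝ} {μ : Measure E} [IsLocallyFiniteMeasure μ]

theorem le_one_of_hasDerivAt_of_le {φ : ℝ → ℝ} {d : ℝ} (h : HasDerivAt φ d 0)
    (hle : ∀ t, 0 ≤ t → φ t ≤ φ 0 + t) : d ≤ 1 := by
  have h1 := h.tendsto_slope_zero_right
  refine le_of_tendsto h1 ?_
  filter_upwards [self_mem_nhdsWithin] with t ht
  have ht' : 0 < t := ht
  rw [zero_add, smul_eq_mul, inv_mul_le_iff₀ ht']
  linarith [hle t ht'.le]

omit [MeasurableSpace E] [BorelSpace E] in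
theorem IsNullHeight.inner_gradient_nullEnvelope_le_one (hu : IsNullHeight u) {a b L : ℝ}
    (hab : ∀ x, nullLength u x ≤ a + b * ‖x‖) (hb : 0 ≤ b) (hL : b ≤ L) {x : E}
    (hd : DifferentiableAt ℝ u x) (hd' : DifferentiableAt ℝ (nullEnvelope u L) x) :
    ⟪gradient u x, gradient (nullEnvelope u L) x⟫ ≤ 1 := by
  have h1 := hd'.hasFDerivAt.hasLineDerivAt (gradient u x)
  rw [real_inner_comm, inner_gradient_left]
  refine le_one_of_hasDerivAt_of_le (φ := fun t => nullEnvelope u L (x + t • gradient u x)) h1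
    fun t ht => ?_
  simpa using hu.nullEnvelope_add_smul_le hab hb hL (hu.gradient_spec hd).2 ht

theorem IsNullHeight.integrable_testFn (hu : IsNullHeight u) (R : ℝ) :
    Integrable (testFn u R) μ :=
  (hu.continuous_testFn R).integrable_of_hasCompactSupport (hu.hasCompactSupport_testFn R)

theorem IsNullHeight.integrable_mul_testWeight (hu : IsNullHeight u) {j : E → ℝ}
    (hj : Measurable j) {a b : ℝ} (hb : 0 ≤ b) (hab : ∀ x, |j x| ≤ a + b * ‖x‖) (R : ℝ) :
    Integrable fun x => j x * testWeight u R x := by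
  obtain ⟨r, hr0, hr⟩ := hu.exists_le_add_softNorm R
  obtain ⟨M, hM0, hM⟩ := hu.exists_testDepth_le R
  refine integrable_of_le_of_eq_zero (r := r) (M := (a + b * r) * (4 * M))
    (hj.mul (hu.measurable_testWeight R)).aestronglyMeasurable (fun x hx => ?_) fun x hx => ?_
  · have h1 : |j x| ≤ a + b * r := (hab x).trans (by gcongr)
    rw [abs_mul, abs_of_nonneg (hu.testWeight_nonneg R x)]
    exact mul_le_mul h1 ((hu.testWeight_le R x).trans (by linarith [hM x]))
      (hu.testWeight_nonneg R x) ((abs_nonneg _).trans h1)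
  · simp [testWeight, testDepth_eq_zero (hr x hx.le)]

/-- In the sense of distributions, the divergence of `nullLength u • ∇u` is at most one if `u` has a
distributional Laplacian which does not charge the points where the null length is positive. -/
theorem IsNullHeight.integral_nullLength_mul_testWeight_le (hu : IsNullHeight u)
    (hμ : ∀ f : E → ℝ, ContDiff ℝ ∞ f → HasCompactSupport f →
      ∫ x, u x * Laplacian.laplacian f x = ∫ x, f x ∂μ)
    (h0 : ∀ᵐ x ∂μ, nullLength u x = 0) (R : ℝ) :
    ∫ x, nullLength u x * testWeight u R x ≤ ∫ x, testFn u R x := by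
  obtain ⟨a, b, -, hb, hab⟩ := hu.exists_nullLength_le
  obtain ⟨r, -, hr⟩ := hu.exists_le_add_softNorm R
  obtain ⟨M, hM0, hM⟩ := hu.exists_testDepth_le R
  obtain ⟨D, hD⟩ := hu.exists_lipschitzWith_testFn R
  have hL : ∀ N : ℕ, b ≤ N + b := fun N => by linarith [N.cast_nonneg (α := ℝ)]
  set j : ℕ → E → ℝ := fun N => nullEnvelope u (N + b)
  have hjlip : ∀ N : ℕ, LipschitzWith ((N : ℝ) + b).toNNReal (j N) := fun N =>
    lipschitzWith_nullEnvelope hab hb (hL N)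
  have hj0 : ∀ N x, nullLength u x ≤ j N x := fun N x => nullLength_le_nullEnvelope hab hb (hL N) x
  have hjabs : ∀ N x, |j N x| ≤ a + b * ‖x‖ := fun N x => by
    rw [abs_of_nonneg ((hu.nullLength_nonneg x).trans (hj0 N x))]
    exact nullEnvelope_le hab hb (hL N) x
  have habs : ∀ x, |nullLength u x| ≤ a + b * ‖x‖ := fun x => by
    rw [abs_of_nonneg (hu.nullLength_nonneg x)]
    exact hab x
  have hint := hu.integrable_mul_testWeight hu.measurable_nullLength hb habs R
  have hkey : ∀ N, ∫ x, nullLength u x * testWeight u R x ≤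
      (∫ x, testFn u R x) + ∫ x, j N x * testFn u R x ∂μ := by
    intro N
    obtain ⟨D', hD'⟩ := exists_lipschitzWith_mul (hjlip N) hD (hu.hasCompactSupport_testFn R)
    rw [integral_eq_neg_integral_inner_gradient hu.lipschitz hμ hD'
      (hu.hasCompactSupport_testFn R).mul_left, ← sub_eq_add_neg, le_sub_iff_add_le]
    have hgrad : (fun x => ⟪gradient u x, gradient (fun x => j N x * testFn u R x) x⟫) =ᵐ[volume]
        fun x => testFn u R x * ⟪gradient u x, gradient (j N) x⟫ - j N x * testWeight u R x := by
      filter_upwards [hu.lipschitz.ae_differentiableAt, (hjlip N).ae_differentiableAt] with x hx hx'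
      have h1 := hx'.hasFDerivAt.mul (hasFDerivAt_testFn (R := R) hx.hasFDerivAt)
      have h2 : fderiv ℝ (fun x => j N x * testFn u R x) x = _ := h1.fderiv
      have h3 : fderiv ℝ u x (gradient u x) = 1 := by
        rw [← inner_gradient_left, real_inner_self_eq_norm_sq, (hu.gradient_spec hx).1, one_pow]
      rw [real_inner_comm, inner_gradient_left, h2, real_inner_comm, inner_gradient_left]
      simp only [add_apply, smul_apply, smul_eq_mul,
        innerSL_apply_apply, h3, testWeight, real_inner_comm]
      ring
    rw [integral_congr_ae hgrad]
    have hI1 : Integrable fun x => testFn u R x * ⟪gradient u x, gradient (j N) x⟫ := by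
      refine integrable_of_le_of_eq_zero (r := r) (M := M ^ 2 * (1 * ((N : ℝ) + b).toNNReal))
        ((hu.continuous_testFn R).measurable.mul ((measurable_gradient u).inner
          (measurable_gradient _))).aestronglyMeasurable (fun x hx => ?_) fun x hx => ?_
      · rw [abs_mul, abs_of_nonneg (testFn_nonneg u R x)]
        refine mul_le_mul (pow_le_pow_left₀ (testDepth_nonneg u R x) (hM x) 2) ?_ (abs_nonneg _)
          (by positivity)
        refine (abs_real_inner_le_norm _ _).trans ?_
        refine mul_le_mul (hu.norm_gradient_le x) ?_ (norm_nonneg _) zero_le_one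
        rw [gradient, LinearIsometryEquiv.norm_map]
        exact norm_fderiv_le_of_lipschitz ℝ (hjlip N)
      · simp [testFn, testDepth_eq_zero (hr x hx.le)]
    have hI2 := hu.integrable_mul_testWeight (hjlip N).continuous.measurable hb (hjabs N) R
    rw [integral_sub hI1 hI2]
    have hle1 : ∫ x, testFn u R x * ⟪gradient u x, gradient (j N) x⟫ ≤ ∫ x, testFn u R x := by
      refine integral_mono_ae hI1 (hu.integrable_testFn R) ?_
      filter_upwards [hu.lipschitz.ae_differentiableAt, (hjlip N).ae_differentiableAt] with x hx hx'
      exact mul_le_of_le_one_right (testFn_nonneg u R x)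
        (hu.inner_gradient_nullEnvelope_le_one hab hb (hL N) hx hx')
    have hle2 : ∫ x, nullLength u x * testWeight u R x ≤ ∫ x, j N x * testWeight u R x :=
      integral_mono hint hI2 fun x =>
        mul_le_mul_of_nonneg_right (hj0 N x) (hu.testWeight_nonneg R x)
    linarith
  have hlim : Tendsto (fun N => ∫ x, j N x * testFn u R x ∂μ) atTop (𝓝 0) := by
    have h1 : Tendsto (fun N => ∫ x, j N x * testFn u R x ∂μ) atTop
        (𝓝 (∫ x, nullLength u x * testFn u R x ∂μ)) := by
      refine tendsto_integral_of_dominated_convergence (fun x => (a + b * ‖x‖) * testFn u R x)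
        (fun N => ((hjlip N).continuous.mul (hu.continuous_testFn R)).aestronglyMeasurable) ?_ ?_
        (Eventually.of_forall fun x => (hu.tendsto_nullEnvelope hab hb x).mul_const _)
      · exact ((continuous_const.add (continuous_const.mul continuous_norm)).mul
          (hu.continuous_testFn R)).integrable_of_hasCompactSupport
          (hu.hasCompactSupport_testFn R).mul_left
      · refine fun N => Eventually.of_forall fun x => ?_
        rw [norm_mul, Real.norm_of_nonneg (testFn_nonneg u R x)]
        exact mul_le_mul_of_nonneg_right (hjabs N x) (testFn_nonneg u R x)
    have h2 : ∫ x, nullLength u x * testFn u R x ∂μ = 0 := by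
      refine integral_eq_zero_of_ae ?_
      filter_upwards [h0] with x hx
      simp [hx]
    rwa [h2] at h1
  have hlim' := hlim.const_add (∫ x, testFn u R x)
  rw [add_zero] at hlim'
  exact ge_of_tendsto' hlim' hkey

end TestFunctions

/-! ### The lower bound for the divergence of the null length -/

section LowerBound

variable {E : Type*} [NormedAddCommGroup E] [InnerProductSpace ℝ E] [FiniteDimensional ℝ E]
  [MeasurableSpace E] [BorelSpace E]

/-- A map which expands distances on a set does not decrease the volume of its subsets. -/
theorem volume_inter_preimage_le {Φ : E → E} {S : Set E}
    (h : ∀ x ∈ S, ∀ y ∈ S, ‖x - y‖ ≤ ‖Φ x - Φ y‖) (A : Set E) :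
    volume (S ∩ Φ ⁻¹' A) ≤ volume A := by
  have hinj : InjOn Φ S := fun x hx y hy hxy => by
    have := h x hx y hy
    rw [hxy, sub_self, norm_zero] at this
    exact sub_eq_zero.1 (norm_le_zero_iff.1 this)
  set ψ : E → E := Function.invFunOn Φ S
  have hψ : LeftInvOn ψ Φ S := hinj.leftInvOn_invFunOn
  have hlip : LipschitzOnWith 1 ψ (Φ '' S) := by
    refine LipschitzOnWith.of_dist_le_mul ?_
    rintro _ ⟨x, hx, rfl⟩ _ ⟨y, hy, rfl⟩
    rw [hψ hx, hψ hy, NNReal.coe_one, one_mul, dist_eq_norm, dist_eq_norm]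
    exact h x hx y hy
  have hsub : S ∩ Φ ⁻¹' A ⊆ ψ '' (A ∩ Φ '' S) := fun x hx =>
    ⟨Φ x, ⟨hx.2, x, hx.1, rfl⟩, hψ hx.1⟩
  have hH : Measure.hausdorffMeasure (Module.finrank ℝ E : ℝ) (S ∩ Φ ⁻¹' A) ≤
      Measure.hausdorffMeasure (Module.finrank ℝ E : ℝ) A := by
    refine (measure_mono hsub).trans (((hlip.mono inter_subset_right).hausdorffMeasure_image_le
      (Nat.cast_nonneg _)).trans ?_)
    simpa using measure_mono inter_subset_left
  rw [Measure.isAddLeftInvariant_eq_smul (volume : Measure E)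
    (Measure.hausdorffMeasure (Module.finrank ℝ E : ℝ))]
  simp only [Measure.smul_apply]
  gcongr

variable {u : E → ℝ}

/-- The flow along the null rays of the graph does not decrease volumes. -/
theorem IsNullHeight.map_add_smul_gradient_le (hu : IsNullHeight u) {t : ℝ} (ht : 0 ≤ t) :
    Measure.map (fun x => x + t • gradient u x) (volume : Measure E) ≤ volume := by
  have hm : Measurable fun x => x + t • gradient u x :=
    measurable_id.add ((measurable_gradient u).const_smul t)
  refine Measure.le_iff.2 fun A hA => ?_
  rw [Measure.map_apply hm hA]
  have hS : (fun x => x + t • gradient u x) ⁻¹' A =ᵐ[volume]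
      ({x | DifferentiableAt ℝ u x} ∩ (fun x => x + t • gradient u x) ⁻¹' A : Set E) := by
    filter_upwards [hu.lipschitz.ae_differentiableAt] with x hx
    exact propext ⟨fun h => ⟨hx, h⟩, fun h => h.2⟩
  rw [measure_congr hS]
  exact volume_inter_preimage_le (fun x hx y hy =>
    (hu.gradient_spec hx).2.norm_sub_le (hu.gradient_spec hy).2 ht) A

/-- The value of `testWeight u R` at time `t` on the null ray starting over `z`. -/
noncomputable def rayWeight (u : E → ℝ) (R : ℝ) (z : E) (t : ℝ) : ℝ :=
  2 * max (R - (u z + t + softNorm 1 (z + t • gradient u z))) 0 *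
    (1 + ⟪gradient u z, softGrad 1 (z + t • gradient u z)⟫)

theorem IsNullHeight.ae_testWeight_eq_rayWeight (hu : IsNullHeight u) (R : ℝ) {t : ℝ}
    (ht : 0 ≤ t) : ∀ᵐ z : E, testWeight u R (z + t • gradient u z) = rayWeight u R z t := by
  have hm : Measurable fun x => x + t • gradient u x :=
    measurable_id.add ((measurable_gradient u).const_smul t)
  have h1 : ∀ᵐ x ∂(Measure.map (fun x => x + t • gradient u x) (volume : Measure E)),
      DifferentiableAt ℝ u x :=
    hu.lipschitz.ae_differentiableAt.filter_mono
      (Measure.absolutelyContinuous_of_le (hu.map_add_smul_gradient_le ht)).ae_le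
  filter_upwards [ae_of_ae_map hm.aemeasurable h1, hu.lipschitz.ae_differentiableAt] with z hz' hz
  obtain ⟨hn, hs⟩ := hu.gradient_spec hz
  rw [testWeight, rayWeight, testDepth, hu.gradient_add_smul hz ht hz',
    hu.eq_of_unit_subgrad hn hs ht]

omit [MeasurableSpace E] [BorelSpace E] in
theorem IsNullHeight.lintegral_rayWeight (hu : IsNullHeight u) (R : ℝ) {z : E}
    (hz : DifferentiableAt ℝ u z) :
    ∫⁻ t in Ioi (0 : ℝ), ENNReal.ofReal (rayWeight u R z t) = ENNReal.ofReal (testFn u R z) := by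
  set ξ := gradient u z
  have hn : ‖ξ‖ = 1 := (hu.gradient_spec hz).1
  set g : ℝ → ℝ := fun t => max (R - (u z + t + softNorm 1 (z + t • ξ))) 0 ^ 2
  have hg : ∀ t, HasDerivAt g (-rayWeight u R z t) t := fun t => by
    have h1 : HasDerivAt (fun t : ℝ => z + t • ξ) ξ t := by
      simpa using ((hasDerivAt_id t).smul_const ξ).const_add z
    have h2 : HasDerivAt (softNorm 1 ∘ fun t : ℝ => z + t • ξ) ⟪softGrad 1 (z + t • ξ), ξ⟫ t :=
      (hasFDerivAt_softNorm one_pos (z + t • ξ)).comp_hasDerivAt t h1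
    have h3 : HasDerivAt (fun t => R - (u z + t + softNorm 1 (z + t • ξ)))
        (-(1 + ⟪softGrad 1 (z + t • ξ), ξ⟫)) t :=
      (((hasDerivAt_id t).const_add (u z)).add h2).const_sub R
    refine ((hasDerivAt_max_zero_sq _).comp t h3).congr_deriv ?_
    rw [rayWeight, real_inner_comm (gradient u z)]
    ring
  have hpos : ∀ t, 0 ≤ rayWeight u R z t := fun t => by
    have h1 := neg_le_of_abs_le (abs_real_inner_le_norm ξ (softGrad 1 (z + t • ξ)))
    rw [hn, one_mul] at h1
    have h2 := norm_softGrad_lt_one one_pos (z + t • ξ)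
    exact mul_nonneg (mul_nonneg two_pos.le (le_max_right _ _)) (by linarith)
  have hlim : Tendsto g atTop (𝓝 0) := by
    refine tendsto_const_nhds.congr' ?_
    filter_upwards [eventually_ge_atTop (R - u z)] with t ht
    have := softNorm_pos one_pos (z + t • ξ)
    simp only [g]
    rw [max_eq_right (by linarith)]
    norm_num
  have hI := integral_Ioi_of_hasDerivAt_of_nonpos' (a := 0) (fun t _ => hg t)
    (fun t _ => neg_nonpos.2 (hpos t)) hlim
  have hint := integrableOn_Ioi_deriv_of_nonpos' (a := 0) (fun t _ => hg t)
    (fun t _ => neg_nonpos.2 (hpos t)) hlim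
  have hint' : IntegrableOn (rayWeight u R z) (Ioi 0) := by simpa using hint.neg
  rw [← ofReal_integral_eq_lintegral_ofReal hint' (Eventually.of_forall hpos)]
  rw [integral_neg, zero_sub, neg_inj] at hI
  rw [hI]
  simp [g, testFn, testDepth]

/-- In the sense of distributions, the divergence of `nullLength u • ∇u` is at least one. Points at
time `t` on a null ray have null length at least `t`, and the flow along the rays does not decrease
volumes. -/
theorem IsNullHeight.integral_testFn_le (hu : IsNullHeight u) (R : ℝ) :
    ∫ x, testFn u R x ≤ ∫ x, nullLength u x * testWeight u R x := by
  obtain ⟨a, b, -, hb, hab⟩ := hu.exists_nullLength_le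
  have hint := hu.integrable_mul_testWeight hu.measurable_nullLength hb
    (fun x => by rw [abs_of_nonneg (hu.nullLength_nonneg x)]; exact hab x) R
  have hnn : ∀ x, 0 ≤ nullLength u x * testWeight u R x := fun x =>
    mul_nonneg (hu.nullLength_nonneg x) (hu.testWeight_nonneg R x)
  rw [← ENNReal.ofReal_le_ofReal_iff (integral_nonneg hnn),
    ofReal_integral_eq_lintegral_ofReal (hu.integrable_testFn R)
      (Eventually.of_forall (testFn_nonneg u R)),
    ofReal_integral_eq_lintegral_ofReal hint (Eventually.of_forall hnn)]
  have hgm := measurable_gradient u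
  set h : E → ℝ → ℝ≥0∞ := fun x t =>
    {p : E × ℝ | p.2 ≤ nullLength u p.1}.indicator
      (fun p => ENNReal.ofReal (testWeight u R p.1)) (x, t) with h_def
  have hhm : Measurable (Function.uncurry h) :=
    (((hu.measurable_testWeight R).comp measurable_fst).ennreal_ofReal).indicator
      (measurableSet_le measurable_snd (hu.measurable_nullLength.comp measurable_fst))
  have hkm : Measurable (Function.uncurry fun z t => ENNReal.ofReal (rayWeight u R z t)) := by
    have h1 : Measurable fun p : E × ℝ => p.1 + p.2 • gradient u p.1 :=
      measurable_fst.add (measurable_snd.smul (hgm.comp measurable_fst))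
    have h2 : Measurable fun p : E × ℝ => u p.1 := hu.continuous.measurable.comp measurable_fst
    have h3 := (continuous_softNorm 1).measurable.comp h1
    have h4 := (continuous_softGrad one_pos).measurable.comp h1
    exact ((((measurable_const.sub ((h2.add measurable_snd).add h3)).max
      measurable_const).const_mul 2).mul
      (((hgm.comp measurable_fst).inner h4).const_add 1)).ennreal_ofReal
  calc ∫⁻ x, ENNReal.ofReal (testFn u R x)
      = ∫⁻ z, ∫⁻ t in Ioi (0 : ℝ), ENNReal.ofReal (rayWeight u R z t) := by
        refine lintegral_congr_ae ?_
        filter_upwards [hu.lipschitz.ae_differentiableAt] with z hz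
        exact (hu.lintegral_rayWeight R hz).symm
    _ = ∫⁻ t in Ioi (0 : ℝ), ∫⁻ z, ENNReal.ofReal (rayWeight u R z t) :=
        lintegral_lintegral_swap hkm.aemeasurable
    _ ≤ ∫⁻ t in Ioi (0 : ℝ), ∫⁻ x, h x t := by
        refine setLIntegral_mono' measurableSet_Ioi fun t ht => ?_
        have ht0 : 0 ≤ t := le_of_lt ht
        have hm : Measurable fun x => x + t • gradient u x :=
          measurable_id.add (hgm.const_smul t)
        have hht : Measurable fun x => h x t := hhm.comp (measurable_id.prodMk measurable_const)
        calc ∫⁻ z, ENNReal.ofReal (rayWeight u R z t)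
            = ∫⁻ z, h (z + t • gradient u z) t := by
              refine lintegral_congr_ae ?_
              filter_upwards [hu.lipschitz.ae_differentiableAt,
                hu.ae_testWeight_eq_rayWeight R ht0] with z hz hz'
              obtain ⟨hn, hs⟩ := hu.gradient_spec hz
              simp only [h_def]
              rw [indicator_of_mem (show _ ∈ {p : E × ℝ | p.2 ≤ nullLength u p.1} from
                hu.le_nullLength_add_smul hn hs ht0), hz']
          _ = ∫⁻ x, h x t ∂(Measure.map (fun x => x + t • gradient u x) volume) :=
              (lintegral_map hht hm).symm
          _ ≤ ∫⁻ x, h x t := lintegral_mono' (hu.map_add_smul_gradient_le ht0) le_rfl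
    _ = ∫⁻ x, ∫⁻ t in Ioi (0 : ℝ), h x t :=
        (lintegral_lintegral_swap hhm.aemeasurable).symm
    _ = ∫⁻ x, ENNReal.ofReal (nullLength u x * testWeight u R x) := by
        refine lintegral_congr fun x => ?_
        have h1 : ∀ t, h x t =
            (Iic (nullLength u x)).indicator (fun _ => ENNReal.ofReal (testWeight u R x)) t :=
          fun t => rfl
        simp_rw [h1]
        rw [lintegral_indicator measurableSet_Iic, lintegral_const,
          Measure.restrict_restrict measurableSet_Iic, Measure.restrict_apply_univ,
          inter_comm, Ioi_inter_Iic, Real.volume_Ioc, sub_zero, mul_comm,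
          ENNReal.ofReal_mul (hu.nullLength_nonneg x)]

end LowerBound

/-! ### Strong convergence of the null lengths -/

section Convergence

variable {E : Type*} [NormedAddCommGroup E] [InnerProductSpace ℝ E]

variable [FiniteDimensional ℝ E] {u : E → ℝ} {uk : ℕ → E → ℝ}

/-- Along a convergent sequence of height functions, the sublevel sets of `uk k + softNorm 1`
stay in a fixed ball: by convexity it is enough to control these functions at the origin and on a
sphere. -/
theorem IsNullHeight.exists_eventually_le_add_softNorm (hu : IsNullHeight u)
    (huk : ∀ k, IsNullHeight (uk k)) (h : ∀ x, Tendsto (fun k => uk k x) atTop (𝓝 (u x)))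
    {R : ℝ} (hR : u 0 + softNorm 1 (0 : E) < R) :
    ∃ r, 0 < r ∧ (∀ x, r ≤ ‖x‖ → R ≤ u x + softNorm 1 x) ∧
      ∀ᶠ k in atTop, ∀ x, r ≤ ‖x‖ → R ≤ uk k x + softNorm 1 x := by
  obtain ⟨r', hr'0, hr'⟩ := hu.exists_le_add_softNorm (R + 1)
  set r := r' + 1
  have hr0 : 0 < r := by positivity
  refine ⟨r, hr0, fun x hx => by linarith [hr' x (by linarith)], ?_⟩
  have hsphere : ∀ᶠ k in atTop, ∀ y ∈ Metric.sphere (0 : E) r, R ≤ uk k y + softNorm 1 y := by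
    by_contra hc
    rw [Filter.not_eventually] at hc
    obtain ⟨φ, hφ, hφR⟩ := extraction_of_frequently_atTop hc
    push Not at hφR
    choose y hyK hy using hφR
    obtain ⟨x, hx, ψ, hψ, hlim⟩ := (isCompact_sphere (0 : E) r).tendsto_subseq hyK
    have hsub : Tendsto (fun k => φ (ψ k)) atTop atTop := hφ.tendsto_atTop.comp hψ.tendsto_atTop
    have h1 := IsNullHeight.tendsto_apply (fun k => huk (φ (ψ k)))
      (fun x => (h x).comp hsub) hlim
    have h2 := h1.add (((continuous_softNorm 1).tendsto x).comp hlim)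
    have h3 : u x + softNorm 1 x ≤ R := le_of_tendsto' h2 fun k => (hy (ψ k)).le
    have h4 := hr' x (by rw [mem_sphere_zero_iff_norm.1 hx]; linarith)
    linarith
  have h0 : ∀ᶠ k in atTop, uk k 0 + softNorm 1 (0 : E) < R :=
    ((h 0).add_const _).eventually_lt_const hR
  filter_upwards [hsphere, h0] with k hk hk0 x hx
  have hxpos : 0 < ‖x‖ := hr0.trans_le hx
  set s := r / ‖x‖
  have hs0 : 0 < s := by positivity
  have hs1 : s ≤ 1 := (div_le_one hxpos).2 hx
  have hys : ‖s • x‖ = r := by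
    rw [norm_smul, Real.norm_of_nonneg hs0.le, div_mul_cancel₀ _ hxpos.ne']
  have hy := hk (s • x) (mem_sphere_zero_iff_norm.2 hys)
  obtain ⟨e, -, he⟩ := (huk k).exists_unit_subgrad (s • x)
  have e0 := he 0
  have e1 := he x
  have f0 := softNorm_add_inner_le one_pos 0 (s • x)
  have f1 := softNorm_add_inner_le one_pos x (s • x)
  simp only [inner_sub_right, inner_zero_right, real_inner_smul_right] at e0 e1 f0 f1
  set p := ⟪e, x⟫
  set q := ⟪softGrad 1 (s • x), x⟫
  nlinarith [mul_le_mul_of_nonneg_left (add_le_add e1 f1) hs0.le,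
    mul_le_mul_of_nonneg_left (add_le_add e0 f0) (sub_nonneg.2 hs1)]

variable [MeasurableSpace E] [BorelSpace E]

theorem IsNullHeight.locallyIntegrable_nullLength {μ : Measure E} [IsLocallyFiniteMeasure μ]
    (hu : IsNullHeight u) : LocallyIntegrable (nullLength u) μ := by
  obtain ⟨a, b, -, hb, hab⟩ := hu.exists_nullLength_le
  have h1 : LocallyIntegrable (fun x : E => a + b * ‖x‖) μ :=
    (continuous_const.add (continuous_const.mul continuous_norm)).locallyIntegrable
  refine h1.mono hu.measurable_nullLength.aestronglyMeasurable (Eventually.of_forall fun x => ?_)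
  rw [Real.norm_of_nonneg (hu.nullLength_nonneg x)]
  exact (hab x).trans (le_abs_self _)

omit [MeasurableSpace E] [BorelSpace E] in
theorem IsNullHeight.exists_testWeight_ge (hu : IsNullHeight u) {K : Set E} (hK : IsCompact K)
    {R : ℝ} (hR : ∀ x ∈ K, u x + softNorm 1 x + 1 ≤ R) :
    ∃ c, 0 < c ∧ ∀ x ∈ K, c ≤ testWeight u R x := by
  rcases K.eq_empty_or_nonempty with rfl | hne
  · exact ⟨1, one_pos, by simp⟩
  obtain ⟨y, -, hy⟩ := hK.exists_isMaxOn hne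
    (continuous_softGrad (E := E) one_pos).norm.continuousOn
  have hpos : 0 < 1 - ‖softGrad 1 y‖ := sub_pos.2 (norm_softGrad_lt_one one_pos y)
  refine ⟨1 - ‖softGrad 1 y‖, hpos, fun x hx => ?_⟩
  have h1 := hu.one_sub_norm_softGrad_le x
  have h2 : ‖softGrad 1 x‖ ≤ ‖softGrad 1 y‖ := hy hx
  have h3 : 1 ≤ testDepth u R x := le_max_of_le_left (by linarith [hR x hx])
  unfold testWeight
  nlinarith

/-- If height functions converge pointwise and the limit has a distributional Laplacian which does
not charge the points with positive null length, then the null lengths converge in `L¹` on compact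
sets. The null lengths are asymptotically bounded above by that of the limit; the two bounds for the
divergence of `nullLength u • ∇u` show that no mass is lost in the limit. -/
theorem IsNullHeight.tendsto_setIntegral_abs_nullLength_sub {μ : Measure E}
    [IsLocallyFiniteMeasure μ] (hu : IsNullHeight u)
    (huk : ∀ k, IsNullHeight (uk k)) (h : ∀ x, Tendsto (fun k => uk k x) atTop (𝓝 (u x)))
    (hμ : ∀ f : E → ℝ, ContDiff ℝ ∞ f → HasCompactSupport f →
      ∫ x, u x * Laplacian.laplacian f x = ∫ x, f x ∂μ)
    (h0 : ∀ᵐ x ∂μ, nullLength u x = 0) {K : Set E} (hK : IsCompact K) :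
    Tendsto (fun k => ∫ x in K, |nullLength (uk k) x - nullLength u x|) atTop (𝓝 0) := by
  obtain ⟨R₀, hR₀⟩ := hK.bddAbove_image (f := fun x => u x + softNorm 1 x)
    (hu.continuous.add (continuous_softNorm 1)).continuousOn
  set R := max (R₀ + 1) (u 0 + softNorm 1 (0 : E) + 1)
  have hRK : ∀ x ∈ K, u x + softNorm 1 x + 1 ≤ R := fun x hx =>
    le_max_of_le_left (by linarith [hR₀ ⟨x, hx, rfl⟩])
  have hR0 : u 0 + softNorm 1 (0 : E) < R := lt_max_of_lt_right (by linarith)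
  obtain ⟨c, hc, hcK⟩ := hu.exists_testWeight_ge hK hRK
  obtain ⟨r, hr0, hr, hrk⟩ := hu.exists_eventually_le_add_softNorm huk h hR0
  obtain ⟨C, hC0, hCk⟩ := hu.exists_eventually_nullLength_le huk h
    (isCompact_closedBall (0 : E) r)
  set M := max (R - u 0 + 1 + r) 0
  have hM0 : 0 ≤ M := le_max_right _ _
  have hdepth : ∀ {w : E → ℝ}, IsNullHeight w → (∀ x, r ≤ ‖x‖ → R ≤ w x + softNorm 1 x) →
      u 0 - 1 < w 0 → ∀ x, testDepth w R x ≤ M := by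
    intro w hw hwr hw0 x
    rcases le_total r ‖x‖ with hx | hx
    · rw [testDepth_eq_zero (hwr x hx)]
      exact hM0
    · refine max_le_max ?_ le_rfl
      have h1 := hw.sub_le 0 x
      rw [zero_sub, norm_neg] at h1
      linarith [softNorm_pos one_pos x]
  have hu0 : ∀ᶠ k in atTop, u 0 - 1 < uk k 0 := (h 0).eventually_const_lt (by linarith)
  have hM := hdepth hu hr (by linarith)
  have hMk : ∀ᶠ k in atTop, ∀ x, testDepth (uk k) R x ≤ M := by
    filter_upwards [hrk, hu0] with k h1 h2 using hdepth (huk k) h1 h2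
  have hbd : ∀ A : ℝ, Integrable ((Metric.closedBall (0 : E) r).indicator fun _ => A) :=
    fun A => (integrable_indicator_iff measurableSet_closedBall).2
      (integrableOn_const (isCompact_closedBall _ _).measure_lt_top.ne)
  have hle : ∀ {A : ℝ} {F : E → ℝ}, (∀ x, ‖x‖ ≤ r → |F x| ≤ A) → (∀ x, r ≤ ‖x‖ → F x = 0) →
      ∀ x, ‖F x‖ ≤ (Metric.closedBall (0 : E) r).indicator (fun _ => A) x := by
    intro A F hA hF x
    by_cases hx : x ∈ Metric.closedBall (0 : E) r
    · rw [indicator_of_mem hx]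
      exact hA x (mem_closedBall_zero_iff.1 hx)
    · rw [indicator_of_notMem hx, hF x (not_le.1 fun h => hx (mem_closedBall_zero_iff.2 h)).le,
        norm_zero]
  have hdepthlim : ∀ x, Tendsto (fun k => testDepth (uk k) R x) atTop (𝓝 (testDepth u R x)) :=
    fun x => (((h x).add_const _).const_sub R).max tendsto_const_nhds
  have hae : ∀ᵐ x : E, DifferentiableAt ℝ u x ∧ ∀ k, DifferentiableAt ℝ (uk k) x :=
    hu.lipschitz.ae_differentiableAt.and
      (ae_all_iff.2 fun k => (huk k).lipschitz.ae_differentiableAt)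
  have hint : ∀ {w w' : E → ℝ}, IsNullHeight w → IsNullHeight w' →
      Integrable fun x => nullLength w x * testWeight w' R x := by
    intro w w' hw hw'
    obtain ⟨a, b, -, hb, hab⟩ := hw.exists_nullLength_le
    exact hw'.integrable_mul_testWeight hw.measurable_nullLength hb
      (fun x => by rw [abs_of_nonneg (hw.nullLength_nonneg x)]; exact hab x) R
  -- the test functions of the sequence converge
  have hlimF : Tendsto (fun k => ∫ x, testFn (uk k) R x) atTop (𝓝 (∫ x, testFn u R x)) := by
    refine tendsto_integral_filter_of_dominated_convergence
      ((Metric.closedBall (0 : E) r).indicator fun _ => M ^ 2)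
      (Eventually.of_forall fun k => ((huk k).continuous_testFn R).aestronglyMeasurable) ?_
      (hbd _) (Eventually.of_forall fun x => (hdepthlim x).pow 2)
    filter_upwards [hrk, hMk] with k h1 h2
    refine Eventually.of_forall (hle (fun x _ => ?_) fun x hx => ?_)
    · rw [abs_of_nonneg (testFn_nonneg _ R x)]
      exact pow_le_pow_left₀ (testDepth_nonneg _ R x) (h2 x) 2
    · simp [testFn, testDepth_eq_zero (h1 x hx)]
  -- replacing the weight of `uk k` by the weight of `u` does not matter in the limit
  have hlimB : Tendsto (fun k => ∫ x, nullLength (uk k) x *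
      (testWeight (uk k) R x - testWeight u R x)) atTop (𝓝 0) := by
    rw [show 𝓝 (0 : ℝ) = 𝓝 (∫ _ : E, (0 : ℝ)) by rw [integral_zero]]
    refine tendsto_integral_filter_of_dominated_convergence
      ((Metric.closedBall (0 : E) r).indicator fun _ => C * (4 * M + 4 * M))
      (Eventually.of_forall fun k => ((huk k).measurable_nullLength.mul
        (((huk k).measurable_testWeight R).sub
          (hu.measurable_testWeight R))).aestronglyMeasurable) ?_ (hbd _) ?_
    · filter_upwards [hrk, hMk, hCk] with k h1 h2 h3
      refine Eventually.of_forall (hle (fun x hx => ?_) fun x hx => ?_)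
      · rw [abs_mul, abs_of_nonneg ((huk k).nullLength_nonneg x)]
        refine mul_le_mul (h3 x (mem_closedBall_zero_iff.2 hx)) ?_ (abs_nonneg _) hC0
        refine (abs_sub _ _).trans (add_le_add ?_ ?_)
        · rw [abs_of_nonneg ((huk k).testWeight_nonneg R x)]
          exact ((huk k).testWeight_le R x).trans (by linarith [h2 x])
        · rw [abs_of_nonneg (hu.testWeight_nonneg R x)]
          exact (hu.testWeight_le R x).trans (by linarith [hM x])
      · simp [testWeight, testDepth_eq_zero (h1 x hx), testDepth_eq_zero (hr x hx)]
    · filter_upwards [hae] with x hx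
      have h1 : Tendsto (fun k => testWeight (uk k) R x) atTop (𝓝 (testWeight u R x)) :=
        ((hdepthlim x).const_mul 2).mul
          (((IsNullHeight.tendsto_gradient huk h hx.1 hx.2).inner tendsto_const_nhds).const_add 1)
      have h2 : Tendsto (fun k => testWeight (uk k) R x - testWeight u R x) atTop (𝓝 0) := by
        simpa using h1.sub_const (testWeight u R x)
      refine h2.zero_mul_isBoundedUnder_le ?_ |>.congr fun k => mul_comm _ _
      refine isBoundedUnder_of_eventually_le (a := nullLength u x + 1) ?_
      filter_upwards [hu.eventually_nullLength_lt huk h (lt_add_one (nullLength u x))] with k hk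
      rw [Function.comp_apply, Real.norm_of_nonneg ((huk k).nullLength_nonneg x)]
      exact hk.le
  -- the positive parts of the differences tend to zero by upper semicontinuity
  have hlimA : Tendsto (fun k => ∫ x, max (nullLength (uk k) x - nullLength u x) 0 *
      testWeight u R x) atTop (𝓝 0) := by
    rw [show 𝓝 (0 : ℝ) = 𝓝 (∫ _ : E, (0 : ℝ)) by rw [integral_zero]]
    refine tendsto_integral_filter_of_dominated_convergence
      ((Metric.closedBall (0 : E) r).indicator fun _ => C * (4 * M))
      (Eventually.of_forall fun k => ((((huk k).measurable_nullLength.sub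
        hu.measurable_nullLength).max measurable_const).mul
          (hu.measurable_testWeight R)).aestronglyMeasurable) ?_ (hbd _)
      (Eventually.of_forall fun x => ?_)
    · filter_upwards [hCk] with k h3
      refine Eventually.of_forall (hle (fun x hx => ?_) fun x hx => ?_)
      · rw [abs_mul, abs_of_nonneg (le_max_right _ _), abs_of_nonneg (hu.testWeight_nonneg R x)]
        refine mul_le_mul (max_le ?_ hC0) ((hu.testWeight_le R x).trans (by linarith [hM x]))
          (hu.testWeight_nonneg R x) hC0
        linarith [h3 x (mem_closedBall_zero_iff.2 hx), hu.nullLength_nonneg x]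
      · simp [testWeight, testDepth_eq_zero (hr x hx)]
    · have h1 : Tendsto (fun k => max (nullLength (uk k) x - nullLength u x) 0) atTop (𝓝 0) := by
        refine tendsto_order.2 ⟨fun b hb => Eventually.of_forall fun k => hb.trans_le
          (le_max_right _ _), fun b hb => ?_⟩
        filter_upwards [hu.eventually_nullLength_lt huk h
          (lt_add_of_pos_right (nullLength u x) hb)] with k hk
        exact max_lt (by linarith) hb
      simpa using h1.mul_const (testWeight u R x)
  have hU := hu.integral_nullLength_mul_testWeight_le hμ h0 R
  have hkey : ∀ k, ∫ x in K, |nullLength (uk k) x - nullLength u x| ≤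
      c⁻¹ * (2 * (∫ x, max (nullLength (uk k) x - nullLength u x) 0 * testWeight u R x) +
        (∫ x, nullLength (uk k) x * (testWeight (uk k) R x - testWeight u R x)) +
        ((∫ x, testFn u R x) - ∫ x, testFn (uk k) R x)) := by
    intro k
    have hL := (huk k).integral_testFn_le R
    have i1 := hint (huk k) (huk k)
    have i2 := hint (huk k) hu
    have i3 := hint hu hu
    have hB : ∫ x, nullLength (uk k) x * (testWeight (uk k) R x - testWeight u R x) =
        (∫ x, nullLength (uk k) x * testWeight (uk k) R x) -
          ∫ x, nullLength (uk k) x * testWeight u R x := by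
      rw [← integral_sub i1 i2]
      simp_rw [mul_sub]
    have i4 : Integrable fun x => max (nullLength (uk k) x - nullLength u x) 0 *
        testWeight u R x := by
      refine (i2.sub i3).pos_part.congr (Eventually.of_forall fun x => ?_)
      simp only [Pi.sub_apply]
      rw [max_mul_of_nonneg _ _ (hu.testWeight_nonneg R x), zero_mul, sub_mul]
    have e1 : ∀ x, |nullLength (uk k) x - nullLength u x| * testWeight u R x =
        2 * (max (nullLength (uk k) x - nullLength u x) 0 * testWeight u R x) -
          nullLength (uk k) x * testWeight u R x + nullLength u x * testWeight u R x := by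
      intro x
      rcases le_total (nullLength (uk k) x - nullLength u x) 0 with hx | hx
      · rw [abs_of_nonpos hx, max_eq_right hx]; ring
      · rw [abs_of_nonneg hx, max_eq_left hx]; ring
    have i5 : Integrable fun x => |nullLength (uk k) x - nullLength u x| * testWeight u R x := by
      simp_rw [e1]
      exact ((i4.const_mul 2).sub i2).add i3
    have e2 : ∫ x, |nullLength (uk k) x - nullLength u x| * testWeight u R x =
        2 * (∫ x, max (nullLength (uk k) x - nullLength u x) 0 * testWeight u R x) -
          (∫ x, nullLength (uk k) x * testWeight u R x) +
          ∫ x, nullLength u x * testWeight u R x := by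
      have i6 : Integrable fun x =>
          2 * (max (nullLength (uk k) x - nullLength u x) 0 * testWeight u R x) -
            nullLength (uk k) x * testWeight u R x := (i4.const_mul 2).sub i2
      simp_rw [e1]
      rw [integral_add i6 i3, integral_sub (i4.const_mul 2) i2,
        integral_const_mul]
    have hKint : c * ∫ x in K, |nullLength (uk k) x - nullLength u x| ≤
        ∫ x, |nullLength (uk k) x - nullLength u x| * testWeight u R x := by
      rw [← integral_const_mul]
      refine le_trans (setIntegral_mono_on ?_ i5.integrableOn hK.measurableSet fun x hx => ?_)
        (setIntegral_le_integral i5 (Eventually.of_forall fun x =>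
          mul_nonneg (abs_nonneg _) (hu.testWeight_nonneg R x)))
      · exact ((((huk k).locallyIntegrable_nullLength.sub
          hu.locallyIntegrable_nullLength).integrableOn_isCompact hK).abs).const_mul c
      · rw [mul_comm]
        exact mul_le_mul_of_nonneg_left (hcK x hx) (abs_nonneg _)
    rw [← div_eq_inv_mul, le_div_iff₀ hc, mul_comm]
    linarith
  have hlim : Tendsto (fun k =>
      c⁻¹ * (2 * (∫ x, max (nullLength (uk k) x - nullLength u x) 0 * testWeight u R x) +
        (∫ x, nullLength (uk k) x * (testWeight (uk k) R x - testWeight u R x)) +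
        ((∫ x, testFn u R x) - ∫ x, testFn (uk k) R x))) atTop (𝓝 0) := by
    have := (((hlimA.const_mul 2).add hlimB).add (hlimF.const_sub
      (∫ x, testFn u R x))).const_mul c⁻¹
    simpa using this
  exact squeeze_zero (fun k => integral_nonneg fun x => abs_nonneg _) hkey hlim

end Convergence

/-! ### Level surfaces of the cosmological time as graphs -/

section LevelHeight

variable {E : Type*} [NormedAddCommGroup E]

/-- The height function of the level surface `H_ε` of the cosmological time of the strict epigraph
of `u`: the points at Lorentzian distance `ε` in the future of the graph of `u`. -/
noncomputable def levelHeight (u : E → ℝ) (ε : ℝ) (x : E) : ℝ := ⨅ y, (u y + softNorm ε (x - y))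

/-- The infimum defining `levelHeight u ε x` is attained at `y`: the point of the level surface over
`x` has Lorentzian distance `ε` to the point `(y, u y)` of the graph of `u`. -/
def IsFoot (u : E → ℝ) (ε : ℝ) (x y : E) : Prop :=
  ∀ z, u y + softNorm ε (x - y) ≤ u z + softNorm ε (x - z)

theorem IsFoot.levelHeight_eq {u : E → ℝ} {ε : ℝ} {x y : E} (h : IsFoot u ε x y) :
    levelHeight u ε x = u y + softNorm ε (x - y) :=
  le_antisymm (ciInf_le ⟨_, by rintro _ ⟨z, rfl⟩; exact h z⟩ y) (le_ciInf h)

variable [InnerProductSpace ℝ E] {u : E → ℝ} {ε : ℝ}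

theorem softNorm_sub_le (hε : 0 < ε) (w d : E) :
    softNorm ε (w - d) ≤
      softNorm ε w - ⟪softGrad ε w, d⟫ + ‖d‖ ^ 2 / (2 * softNorm ε w) := by
  have hw := softNorm_pos hε w
  have h1 := softNorm_sq ε w
  have h2 := softNorm_sq ε (w - d)
  rw [norm_sub_sq_real] at h2
  rw [softGrad, real_inner_smul_left]
  have h3 : softNorm ε w - (softNorm ε w)⁻¹ * ⟪w, d⟫ + ‖d‖ ^ 2 / (2 * softNorm ε w) =
      (2 * softNorm ε w ^ 2 - 2 * ⟪w, d⟫ + ‖d‖ ^ 2) / (2 * softNorm ε w) := by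
    field_simp
  rw [h3, le_div_iff₀ (by positivity)]
  nlinarith [sq_nonneg (softNorm ε w - softNorm ε (w - d))]

theorem IsNullHeight.le_convex_comb (hu : IsNullHeight u) (x y : E) {s : ℝ} (hs0 : 0 ≤ s)
    (hs1 : s ≤ 1) : u (x + s • (y - x)) ≤ (1 - s) * u x + s * u y := by
  obtain ⟨e, -, he⟩ := hu.exists_unit_subgrad (x + s • (y - x))
  have e0 := he x
  have e1 := he y
  have h0 : x - (x + s • (y - x)) = (-s) • (y - x) := by rw [neg_smul]; abel
  have h1 : y - (x + s • (y - x)) = (1 - s) • (y - x) := by rw [sub_smul, one_smul]; abel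
  rw [h0, real_inner_smul_right] at e0
  rw [h1, real_inner_smul_right] at e1
  nlinarith [mul_le_mul_of_nonneg_left e1 hs0, mul_le_mul_of_nonneg_left e0 (sub_nonneg.2 hs1)]

/-- The level surface has at the point over `x` a tangent plane parallel to a support plane of the
graph of `u` at the foot. -/
theorem IsFoot.isSubgrad (hε : 0 < ε) (hu : IsNullHeight u) {x y : E} (h : IsFoot u ε x y) :
    IsSubgrad u y (softGrad ε (x - y)) := by
  intro z
  set w := x - y
  set d := z - y
  set A := ‖d‖ ^ 2 / (2 * softNorm ε w) with hA
  have hw := softNorm_pos hε w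
  have hA0 : 0 ≤ A := by positivity
  have key : ∀ s : ℝ, 0 < s → s ≤ 1 → u y + ⟪softGrad ε w, d⟫ ≤ u z + s * A := by
    intro s hs0 hs1
    have h1 := h (y + s • d)
    have h2 := hu.le_convex_comb y z hs0.le hs1
    have h3 := softNorm_sub_le hε w (s • d)
    have h4 : x - (y + s • d) = w - s • d := by simp only [w]; abel
    rw [h4] at h1
    rw [real_inner_smul_right, norm_smul, mul_pow, Real.norm_of_nonneg hs0.le, mul_div_assoc,
      ← hA] at h3
    have h5 : s * (u y + ⟪softGrad ε w, d⟫) ≤ s * (u z + s * A) := by nlinarith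
    exact le_of_mul_le_mul_left h5 hs0
  have hlim : Tendsto (fun s : ℝ => u z + s * A) (𝓝[>] 0) (𝓝 (u z + 0 * A)) :=
    ((continuous_const.add (continuous_id.mul continuous_const)).tendsto (0 : ℝ)).mono_left
      nhdsWithin_le_nhds
  rw [zero_mul, add_zero] at hlim
  refine ge_of_tendsto hlim ?_
  filter_upwards [Ioc_mem_nhdsGT (zero_lt_one (α := ℝ))] with s hs
  exact key s hs.1 hs.2

theorem IsFoot.levelHeight_add_inner_le (hε : 0 < ε) (hu : IsNullHeight u) {x y : E}
    (h : IsFoot u ε x y) (x' : E) :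
    levelHeight u ε x + ⟪softGrad ε (x - y), x' - x⟫ ≤ levelHeight u ε x' := by
  rw [h.levelHeight_eq]
  refine le_ciInf fun z => ?_
  have h1 := h.isSubgrad hε hu z
  have h2 := softNorm_add_inner_le hε (x' - z) (x - y)
  have h3 : x' - z - (x - y) = (x' - x) - (z - y) := by abel
  rw [h3, inner_sub_right] at h2
  linarith

theorem IsFoot.levelHeight_le (hε : 0 < ε) (hu : IsNullHeight u) {x y : E}
    (h : IsFoot u ε x y) (x' : E) : levelHeight u ε x' ≤ u y + softNorm ε (x' - y) := by
  refine ciInf_le ⟨levelHeight u ε x + ⟪softGrad ε (x - y), x' - x⟫, ?_⟩ y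
  rintro _ ⟨z, rfl⟩
  rw [h.levelHeight_eq]
  have h1 := h.isSubgrad hε hu z
  have h2 := softNorm_add_inner_le hε (x' - z) (x - y)
  have h3 : x' - z - (x - y) = (x' - x) - (z - y) := by abel
  rw [h3, inner_sub_right] at h2
  linarith

/-- The level surface is squeezed at each of its points between a plane and a hyperboloid. -/
theorem IsFoot.hasFDerivAt_levelHeight (hε : 0 < ε) (hu : IsNullHeight u) {x y : E}
    (h : IsFoot u ε x y) :
    HasFDerivAt (levelHeight u ε) (innerSL ℝ (softGrad ε (x - y))) x := by
  have h1 : HasFDerivAt (fun x' => u y + softNorm ε (x' - y))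
      (innerSL ℝ (softGrad ε (x - y))) x := by
    have := (hasFDerivAt_softNorm hε (x - y)).comp x ((hasFDerivAt_id x).sub_const y)
    exact this.const_add (u y)
  rw [hasFDerivAt_iff_isLittleO] at h1 ⊢
  refine Asymptotics.IsBigO.trans_isLittleO (Asymptotics.isBigO_of_le _ fun x' => ?_) h1
  have h2 := h.levelHeight_add_inner_le hε hu x'
  have h3 := h.levelHeight_le hε hu x'
  simp only [innerSL_apply_apply]
  rw [← h.levelHeight_eq, Real.norm_of_nonneg (by linarith), Real.norm_of_nonneg (by linarith)]
  linarith

theorem norm_sub_le_of_add_softNorm_le {m : E} {c : ℝ}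
    (hc : ∀ y, ⟪m, y⟫ + c ≤ u y) {x y : E} (h : u y + softNorm ε (x - y) ≤ u x + ε) :
    (1 - ‖m‖) * ‖x - y‖ ≤ u x - ⟪m, x⟫ - c + ε := by
  have h1 := hc y
  have h2 := real_inner_le_norm m (x - y)
  have h3 : ‖x - y‖ ≤ softNorm ε (x - y) := Real.le_sqrt_of_sq_le (by nlinarith)
  rw [inner_sub_right] at h2
  linarith

omit [InnerProductSpace ℝ E] in
theorem softNorm_zero (hε : 0 ≤ ε) : softNorm ε (0 : E) = ε := by
  simp [softNorm, Real.sqrt_sq hε]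

theorem IsNullHeight.exists_isFoot [FiniteDimensional ℝ E] (hu : IsNullHeight u) (hε : 0 ≤ ε)
    (x : E) : ∃ y, IsFoot u ε x y := by
  obtain ⟨m, c, hm, hc⟩ := hu.coercive
  have hpos : 0 < 1 - ‖m‖ := by linarith
  set r := (u x - ⟪m, x⟫ - c + ε) / (1 - ‖m‖)
  have hcont : Continuous fun y => u y + softNorm ε (x - y) :=
    hu.continuous.add ((continuous_softNorm ε).comp (continuous_const.sub continuous_id))
  have hball : ∀ y, u y + softNorm ε (x - y) ≤ u x + ε → y ∈ Metric.closedBall x r := by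
    intro y hy
    rw [Metric.mem_closedBall, dist_comm, dist_eq_norm, le_div_iff₀ hpos, mul_comm]
    exact norm_sub_le_of_add_softNorm_le hc hy
  have hself : u x + softNorm ε (x - x) ≤ u x + ε := by rw [sub_self, softNorm_zero hε]
  obtain ⟨y, -, hy⟩ := (isCompact_closedBall x r).exists_isMinOn ⟨x, hball x hself⟩
    hcont.continuousOn
  refine ⟨y, fun z => ?_⟩
  rcases le_total (u z + softNorm ε (x - z)) (u x + ε) with hz | hz
  · exact hy (hball z hz)
  · exact (hy (hball x hself)).trans (hself.trans hz)

omit [InnerProductSpace ℝ E] in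
theorem IsFoot.add_softNorm_le (hε : 0 ≤ ε) {x y : E} (h : IsFoot u ε x y) :
    u y + softNorm ε (x - y) ≤ u x + ε := by
  simpa [softNorm_zero hε] using h x

/-- The foot lies at least as far from `x` as the past end of the null segment ending over `x`. -/
theorem IsFoot.nullLength_le [FiniteDimensional ℝ E] (hε : 0 < ε) (hu : IsNullHeight u) {x y : E}
    (h : IsFoot u ε x y) : nullLength u x ≤ ‖x - y‖ := by
  obtain ⟨z, hz, hz'⟩ := hu.exists_mem_nullPast x
  have hz1 : u x - u z = ‖x - z‖ := hz
  have h1 := h z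
  have h2 := hu.sub_le x y
  have h3 := softNorm_sq ε (x - y)
  have h4 := softNorm_sq ε (x - z)
  rw [← hz']
  by_contra hlt
  push Not at hlt
  have h5 := norm_lt_softNorm hε (x - y)
  have h6 := norm_lt_softNorm hε (x - z)
  have h7 : softNorm ε (x - y) - ‖x - y‖ ≤ softNorm ε (x - z) - ‖x - z‖ := by linarith
  have h8 : softNorm ε (x - y) < softNorm ε (x - z) := by linarith
  nlinarith [norm_nonneg (x - y)]

/-- The vertical distances between the level surfaces and their feet converge to the null length. -/
theorem IsNullHeight.tendsto_softNorm_foot [FiniteDimensional ℝ E] (hu : IsNullHeight u) {x : E}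
    {Y : ℝ → E} (hY : ∀ ε, 0 < ε → IsFoot u ε x (Y ε)) :
    Tendsto (fun ε => softNorm ε (x - Y ε)) (𝓝[>] 0) (𝓝 (nullLength u x)) := by
  refine tendsto_order.2 ⟨fun c hc => ?_, fun c hc => ?_⟩
  · filter_upwards [self_mem_nhdsWithin] with ε hε
    exact hc.trans_le (((hY ε hε).nullLength_le hε hu).trans (norm_lt_softNorm hε _).le)
  · by_contra hcon
    rw [Filter.not_eventually] at hcon
    have hcon' : ∃ᶠ ε in 𝓝[>] (0 : ℝ), ¬ softNorm ε (x - Y ε) < c ∧ ε ∈ Ioc (0 : ℝ) 1 :=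
      hcon.and_eventually (Ioc_mem_nhdsGT zero_lt_one)
    obtain ⟨e, he, hef⟩ := exists_seq_forall_of_frequently hcon'
    have he0 : Tendsto e atTop (𝓝 0) := he.mono_right nhdsWithin_le_nhds
    obtain ⟨m, c', hm, hc'⟩ := hu.coercive
    have hpos : 0 < 1 - ‖m‖ := by linarith
    have hmem : ∀ k, Y (e k) ∈ Metric.closedBall x ((u x - ⟪m, x⟫ - c' + 1) / (1 - ‖m‖)) := by
      intro k
      obtain ⟨-, h0, h1⟩ := hef k
      rw [Metric.mem_closedBall, dist_comm, dist_eq_norm, le_div_iff₀ hpos, mul_comm]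
      have := norm_sub_le_of_add_softNorm_le hc' ((hY (e k) h0).add_softNorm_le h0.le)
      linarith
    obtain ⟨y, -, φ, hφ, hlim⟩ := (isCompact_closedBall x _).tendsto_subseq hmem
    have hsub : Tendsto (fun k => e (φ k)) atTop (𝓝 0) := he0.comp hφ.tendsto_atTop
    have hN : Tendsto (fun k => softNorm (e (φ k)) (x - Y (e (φ k)))) atTop (𝓝 ‖x - y‖) := by
      have h1 := ((hsub.pow 2).add (((tendsto_const_nhds (x := x)).sub hlim).norm.pow 2)).sqrt
      simpa [softNorm, Real.sqrt_sq (norm_nonneg (x - y))] using h1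
    have hu' : Tendsto (fun k => u (Y (e (φ k)))) atTop (𝓝 (u y)) :=
      (hu.continuous.tendsto y).comp hlim
    have hle : u y + ‖x - y‖ ≤ u x + 0 :=
      le_of_tendsto_of_tendsto' (hu'.add hN) (hsub.const_add (u x)) fun k =>
        (hY _ (hef (φ k)).2.1).add_softNorm_le (hef (φ k)).2.1.le
    have hy : y ∈ nullPast u x := le_antisymm (hu.sub_le x y) (by linarith)
    have h1 := hu.norm_sub_le_nullLength hy
    have h2 : c ≤ ‖x - y‖ := ge_of_tendsto' hN fun k => not_lt.1 (hef (φ k)).1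
    linarith

end LevelHeight

/-! ### The splitting of Minkowski space along a timelike direction -/

section Splitting

variable {n : ℕ}

/-- Reverse Cauchy–Schwarz: a future directed timelike vector and a future directed nonzero causal
vector have negative product. -/
theorem mform_neg_of_causal {a w : Mink n} (ha : mform n a a ≤ 0) (ha0 : 0 < a 0)
    (hw : mform n w w < 0) (hw0 : 0 < w 0) : mform n a w < 0 := by
  rw [mform_apply] at *
  have hcs := Finset.sum_mul_sq_le_sq_mul_sq Finset.univ
    (fun i : Fin n => a i.succ) (fun i : Fin n => w i.succ)
  simp only [← pow_two] at ha hw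
  have h1 : 0 ≤ ∑ i : Fin n, w i.succ ^ 2 := Finset.sum_nonneg fun i _ => sq_nonneg _
  have h2 : 0 < a 0 ^ 2 := pow_pos ha0 2
  have h3 : (∑ i : Fin n, a i.succ * w i.succ) ^ 2 < (a 0 * w 0) ^ 2 := by
    calc _ ≤ _ := hcs
      _ ≤ a 0 ^ 2 * ∑ i : Fin n, w i.succ ^ 2 := by gcongr; linarith
      _ < a 0 ^ 2 * w 0 ^ 2 := by gcongr; linarith
      _ = _ := by ring
  have h4 := abs_lt.1 (abs_lt_of_sq_lt_sq h3 (by positivity))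
  linarith [h4.2]

variable (v : Hyp n)

/-- The decomposition `ℝ^{n,1} = P_v ⊕ ℝv`. -/
noncomputable def splitEquiv : (SpacePlane v × ℝ) ≃L[ℝ] Mink n :=
  LinearEquiv.toContinuousLinearEquiv
    { toFun := fun p => SpacePlane.incl v p.1 + p.2 • v.1
      map_add' := fun p q => by
        simp only [Prod.fst_add, Prod.snd_add, map_add, add_smul]; abel
      map_smul' := fun c p => by
        simp [smul_add, smul_smul]
      invFun := fun q => (⟨q + mform n v.1 q • v.1, by
        rw [LinearMap.mem_ker, map_add, map_smul, v.2.1]; simp⟩, -mform n v.1 q)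
      left_inv := fun p => by
        have h1 : mform n v.1 (SpacePlane.incl v p.1 + p.2 • v.1) = -p.2 := by
          rw [map_add, map_smul, SpacePlane.mform_incl, v.2.1]; simp
        refine Prod.ext (SpacePlane.incl_injective v ?_) ?_
        · change SpacePlane.incl v p.1 + p.2 • v.1 +
            mform n v.1 (SpacePlane.incl v p.1 + p.2 • v.1) • v.1 = SpacePlane.incl v p.1
          rw [h1, neg_smul, add_neg_cancel_right]
        · simp only [h1, neg_neg]
      right_inv := fun q => by
        change q + mform n v.1 q • v.1 + (-mform n v.1 q) • v.1 = q
        rw [neg_smul, add_neg_cancel_right] }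

/-- The point `x + tv`. -/
noncomputable def splitPt (x : SpacePlane v) (t : ℝ) : Mink n := SpacePlane.incl v x + t • v.1

theorem splitEquiv_apply (p : SpacePlane v × ℝ) : splitEquiv v p = splitPt v p.1 p.2 := rfl

theorem exists_splitPt (q : Mink n) : ∃ x t, splitPt v x t = q :=
  ⟨((splitEquiv v).symm q).1, ((splitEquiv v).symm q).2, (splitEquiv v).apply_symm_apply q⟩

theorem continuous_splitPt : Continuous fun p : SpacePlane v × ℝ => splitPt v p.1 p.2 :=
  (splitEquiv v).continuous

theorem splitPt_sub (x y : SpacePlane v) (t s : ℝ) :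
    splitPt v x t - splitPt v y s = splitPt v (x - y) (t - s) := by
  simp only [splitPt, map_sub, sub_smul]; abel

theorem smul_splitPt (c : ℝ) (x : SpacePlane v) (t : ℝ) :
    c • splitPt v x t = splitPt v (c • x) (c * t) := by
  simp only [splitPt, map_smul, smul_add, smul_smul]

theorem mform_splitPt (x y : SpacePlane v) (t s : ℝ) :
    mform n (splitPt v x t) (splitPt v y s) = ⟪x, y⟫ - t * s := by
  have h1 := SpacePlane.mform_incl v x
  have h2 := SpacePlane.mform_incl v y
  rw [mform_comm] at h1
  simp only [splitPt, map_add, map_smul, LinearMap.add_apply, LinearMap.smul_apply, h1, h2, v.2.1,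
    smul_eq_mul, SpacePlane.inner_def]
  ring

theorem mform_splitPt_self (x : SpacePlane v) (t : ℝ) :
    mform n (splitPt v x t) (splitPt v x t) = ‖x‖ ^ 2 - t ^ 2 := by
  rw [mform_splitPt, real_inner_self_eq_norm_sq, sq t]

theorem mform_splitPt_dir (x : SpacePlane v) (t : ℝ) : mform n (splitPt v x t) v.1 = -t := by
  have h : splitPt v 0 1 = v.1 := by simp [splitPt]
  rw [← h, mform_splitPt]
  simp

/-- A causal vector is future directed if and only if its component along `v` is positive. -/
theorem splitPt_zero_pos_iff {x : SpacePlane v} {t : ℝ} (h : ‖x‖ ^ 2 - t ^ 2 ≤ 0) (ht : t ≠ 0) :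
    0 < splitPt v x t 0 ↔ 0 < t := by
  have key : ∀ (x : SpacePlane v) (t : ℝ), ‖x‖ ^ 2 - t ^ 2 ≤ 0 → 0 < splitPt v x t 0 → 0 < t := by
    intro x t h h0
    have h1 := mform_neg_of_causal (a := splitPt v x t) (w := v.1)
      (by rw [mform_splitPt_self]; exact h) h0 (by rw [v.2.1]; norm_num) v.2.2
    rw [mform_splitPt_dir] at h1
    linarith
  refine ⟨key x t h, fun ht0 => ?_⟩
  by_contra hc
  push Not at hc
  have hneg : splitPt v (-x) (-t) = -splitPt v x t := by simp [splitPt]; abel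
  rcases hc.lt_or_eq with hlt | heq
  · have := key (-x) (-t) (by simpa using h) (by rw [hneg]; simpa using hlt)
    linarith
  · have hm : mform n (splitPt v x t) (splitPt v x t) ≤ 0 := by rw [mform_splitPt_self]; exact h
    rw [mform_apply, heq] at hm
    have h0 : ∀ i : Fin n, splitPt v x t i.succ = 0 := fun i => by
      have hs : ∑ i : Fin n, splitPt v x t i.succ * splitPt v x t i.succ = 0 :=
        le_antisymm (by linarith) (Finset.sum_nonneg fun i _ => mul_self_nonneg _)
      have := (Finset.sum_eq_zero_iff_of_nonneg
        (fun i _ => mul_self_nonneg (splitPt v x t (Fin.succ i)))).1 hs i (Finset.mem_univ i)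
      exact mul_self_eq_zero.1 this
    have hz : splitPt v x t = 0 := by
      funext i
      exact Fin.cases heq h0 i
    have h1 := mform_splitPt_dir v x t
    rw [hz] at h1
    simp at h1
    exact ht h1

theorem chronPrec_splitPt {x y : SpacePlane v} {t s : ℝ} :
    ChronPrec (splitPt v x t) (splitPt v y s) ↔ ‖y - x‖ < s - t := by
  have h0 : splitPt v x t 0 < splitPt v y s 0 ↔ 0 < splitPt v (y - x) (s - t) 0 := by
    rw [← splitPt_sub, Pi.sub_apply, sub_pos]
  rw [ChronPrec, h0, splitPt_sub, mform_splitPt_self]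
  constructor
  · rintro ⟨h1, h2⟩
    have hne : s - t ≠ 0 := fun h => by
      rw [h] at h1
      nlinarith [sq_nonneg ‖y - x‖]
    have h3 := (splitPt_zero_pos_iff v h1.le hne).1 h2
    exact lt_of_pow_lt_pow_left₀ 2 h3.le (by linarith)
  · intro h
    have h3 : 0 < s - t := (norm_nonneg _).trans_lt h
    have h1 : ‖y - x‖ ^ 2 - (s - t) ^ 2 < 0 := by
      have := pow_lt_pow_left₀ h (norm_nonneg _) two_ne_zero
      linarith
    exact ⟨h1, (splitPt_zero_pos_iff v h1.le h3.ne').2 h3⟩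

/-- The future of a lightlike hyperplane is the epigraph of an affine function of unit slope. -/
theorem IsLightlikeHyperplane.exists_slope {P : AffineSubspace ℝ (Mink n)}
    (hP : IsLightlikeHyperplane P) : ∃ (e : SpacePlane v) (c : ℝ), ‖e‖ = 1 ∧
      P = AffineSubspace.mk' (splitPt v 0 c) (LinearMap.ker (mform n (splitPt v e 1))) ∧
      (∀ x t, splitPt v x t ∈ P ↔ t = ⟪e, x⟫ + c) ∧
      ∀ x t, splitPt v x t ∈ chronFuture (P : Set (Mink n)) ↔ ⟪e, x⟫ + c < t := by
  obtain ⟨a, l, hl, hll, rfl⟩ := hP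
  obtain ⟨x₀, s, rfl⟩ := exists_splitPt v l
  obtain ⟨y, b, rfl⟩ := exists_splitPt v a
  rw [mform_splitPt_self] at hll
  have hs : s ≠ 0 := by
    rintro rfl
    have : x₀ = 0 := by
      have h1 : ‖x₀‖ ^ 2 = 0 := by linarith
      exact norm_eq_zero.1 (pow_eq_zero_iff two_ne_zero |>.1 h1)
    rw [this] at hl
    exact hl (by simp [splitPt])
  have habs : ‖x₀‖ = |s| := by
    rw [← abs_of_nonneg (norm_nonneg x₀)]
    exact (sq_eq_sq_iff_abs_eq_abs _ _).1 (by linarith)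
  set e := s⁻¹ • x₀ with he
  have hx₀ : x₀ = s • e := by rw [he, smul_inv_smul₀ hs]
  have he1 : ‖e‖ = 1 := by
    rw [he, norm_smul, habs, norm_inv, Real.norm_eq_abs, inv_mul_cancel₀ (abs_ne_zero.2 hs)]
  have hl' : splitPt v x₀ s = s • splitPt v e 1 := by rw [smul_splitPt, mul_one, ← hx₀]
  have hker : LinearMap.ker (mform n (splitPt v x₀ s)) =
      LinearMap.ker (mform n (splitPt v e 1)) := by
    rw [hl', map_smul, LinearMap.ker_smul _ _ hs]
  set c := b - ⟪e, y⟫ with hc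
  have hmem : ∀ x t, splitPt v x t ∈ AffineSubspace.mk' (splitPt v y b)
      (LinearMap.ker (mform n (splitPt v x₀ s))) ↔ t = ⟪e, x⟫ + c := by
    intro x t
    rw [hker, AffineSubspace.mem_mk', vsub_eq_sub, LinearMap.mem_ker, splitPt_sub, mform_splitPt,
      inner_sub_right]
    constructor <;> intro h <;> linarith
  refine ⟨e, c, he1, ?_, hmem, fun x t => ?_⟩
  · rw [← hker]
    refine AffineSubspace.eq_of_direction_eq_of_nonempty_of_le ?_ ?_ ?_ |>.symm
    · simp
    · exact ⟨_, AffineSubspace.self_mem_mk' _ _⟩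
    · intro q hq
      obtain ⟨x, t, rfl⟩ := exists_splitPt v q
      rw [hmem]
      rw [hker, AffineSubspace.mem_mk', vsub_eq_sub, LinearMap.mem_ker, splitPt_sub, mform_splitPt,
        sub_zero] at hq
      linarith
  · constructor
    · rintro ⟨p, hp, hpq⟩
      obtain ⟨z, r, rfl⟩ := exists_splitPt v p
      rw [SetLike.mem_coe, hmem] at hp
      rw [chronPrec_splitPt] at hpq
      have h1 := real_inner_le_norm e (x - z)
      rw [he1, one_mul, inner_sub_right] at h1
      linarith
    · intro h
      refine ⟨splitPt v x (⟪e, x⟫ + c), (hmem _ _).2 rfl, ?_⟩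
      rw [chronPrec_splitPt, sub_self, norm_zero]
      linarith

end Splitting

/-! ### Domains of dependence as epigraphs -/

section Height

variable {n : ℕ} (v : Hyp n)

/-- `D` is the strict epigraph of `u` over `P_v`. -/
def IsEpigraph (D : Set (Mink n)) (u : SpacePlane v → ℝ) : Prop :=
  ∀ x t, splitPt v x t ∈ D ↔ u x < t

theorem IsDomainOfDependence.exists_isNullHeight {D : Set (Mink n)} (hD : IsDomainOfDependence D) :
    ∃ u : SpacePlane v → ℝ, IsNullHeight u ∧ IsEpigraph v D u := by
  obtain ⟨F, hF, hDF⟩ := hD.eq_iInter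
  obtain ⟨P, Q, hP, hQ, hPQ, hPD, hQD⟩ := hD.two_planes
  -- the parameters of the lightlike hyperplanes of the family
  set A : Set (SpacePlane v × ℝ) := {p | ‖p.1‖ = 1 ∧
    ∀ x t, splitPt v x t ∈ D → ⟪p.1, x⟫ + p.2 < t} with hA
  have hmemD : ∀ x t, splitPt v x t ∈ D ↔ ∀ p ∈ A, ⟪p.1, x⟫ + p.2 < t := by
    intro x t
    refine ⟨fun h p hp => hp.2 x t h, fun h => ?_⟩
    rw [hDF, mem_iInter₂]
    intro R hR
    obtain ⟨e, c, he, -, -, hfut⟩ := (hF R hR).exists_slope v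
    refine (hfut x t).2 (h (e, c) ⟨he, fun y s hy => (hfut y s).1 ?_⟩)
    rw [hDF, mem_iInter₂] at hy
    exact hy R hR
  obtain ⟨q, hq⟩ := hD.nonempty
  obtain ⟨x₁, t₁, rfl⟩ := exists_splitPt v q
  have hAne : A.Nonempty := by
    by_contra hne
    rw [not_nonempty_iff_eq_empty] at hne
    obtain ⟨e, c, -, -, hmem, -⟩ := hP.exists_slope v
    have h1 : splitPt v 0 c ∈ P := (hmem 0 c).2 (by simp)
    exact hPD h1 ((hmemD 0 c).2 (by simp [hne]))
  have hbdd : ∀ x, BddAbove ((fun p : SpacePlane v × ℝ => ⟪p.1, x⟫ + p.2) '' A) := by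
    intro x
    refine ⟨t₁ + ‖x - x₁‖, ?_⟩
    rintro _ ⟨p, hp, rfl⟩
    have h1 := hp.2 x₁ t₁ hq
    have h2 := real_inner_le_norm p.1 (x - x₁)
    rw [hp.1, one_mul, inner_sub_right] at h2
    simp only
    linarith
  set u : SpacePlane v → ℝ := fun x => sSup ((fun p : SpacePlane v × ℝ => ⟪p.1, x⟫ + p.2) '' A)
  have hle : ∀ p ∈ A, ∀ x, ⟪p.1, x⟫ + p.2 ≤ u x := fun p hp x => le_csSup (hbdd x) ⟨p, hp, rfl⟩
  have hepi : IsEpigraph v D u := by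
    intro x t
    constructor
    · intro h
      -- openness gives room below `t`
      have hcont : Continuous fun s => splitPt v x s :=
        (continuous_splitPt v).comp (continuous_const.prodMk continuous_id)
      have hev : ∀ᶠ s in 𝓝 t, splitPt v x s ∈ D := (hD.isOpen.preimage hcont).mem_nhds h
      obtain ⟨s, hs, hst⟩ := (hev.filter_mono nhdsWithin_le_nhds |>.and
        (self_mem_nhdsWithin : Iio t ∈ 𝓝[<] t)).exists
      refine lt_of_le_of_lt (csSup_le (hAne.image _) ?_) hst
      rintro _ ⟨p, hp, rfl⟩
      exact (hp.2 x s hs).le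
    · exact fun h => (hmemD x t).2 fun p hp => (hle p hp x).trans_lt h
  have hplane : ∀ {R : AffineSubspace ℝ (Mink n)}, IsLightlikeHyperplane R →
      (R : Set (Mink n)) ⊆ Dᶜ → ∃ (e : SpacePlane v) (c : ℝ), ‖e‖ = 1 ∧
        R = AffineSubspace.mk' (splitPt v 0 c) (LinearMap.ker (mform n (splitPt v e 1))) ∧
        ∀ x, ⟪e, x⟫ + c ≤ u x := by
    intro R hR hRD
    obtain ⟨e, c, he, heq, hmem, -⟩ := hR.exists_slope v
    refine ⟨e, c, he, heq, fun x => not_lt.1 fun hlt => ?_⟩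
    exact hRD ((hmem x _).2 rfl) ((hepi x _).2 hlt)
  obtain ⟨e, c, he, hPe, hPu⟩ := hplane hP hPD
  obtain ⟨e', c', he', hQe, hQu⟩ := hplane hQ hQD
  have hne : e ≠ e' := by
    rintro rfl
    apply hPQ
    rw [hPe, hQe, AffineSubspace.parallel_iff_direction_eq_and_eq_bot_iff_eq_bot]
    have hbot : ∀ (p : Mink n) (d : Submodule ℝ (Mink n)), AffineSubspace.mk' p d ≠ ⊥ :=
      fun p d h => AffineSubspace.notMem_bot ℝ _ p (h ▸ AffineSubspace.self_mem_mk' p d)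
    simp [hbot]
  refine ⟨u, ⟨fun x => ?_, (1 / 2 : ℝ) • (e + e'), (c + c') / 2, ?_, fun y => ?_⟩, hepi⟩
  · -- the supremum over the family is attained in its closure
    obtain ⟨w, -, hw, hwA⟩ := exists_seq_tendsto_sSup (hAne.image _) (hbdd x)
    choose p hpA hpw using hwA
    obtain ⟨f, hf, φ, hφ, hlim⟩ := (isCompact_sphere (0 : SpacePlane v) 1).tendsto_subseq
      (x := fun k => (p k).1) (fun k => by simpa using (hpA k).1)
    refine ⟨f, by simpa using hf, fun y => ?_⟩
    have h1 : Tendsto (fun k => w (φ k) + ⟪(p (φ k)).1, y - x⟫) atTop (𝓝 (u x + ⟪f, y - x⟫)) :=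
      (hw.comp hφ.tendsto_atTop).add (hlim.inner tendsto_const_nhds)
    refine le_of_tendsto' h1 fun k => ?_
    rw [← hpw, inner_sub_right]
    have := hle _ (hpA (φ k)) y
    simp only
    linarith
  · have h1 : ‖(e + e' : SpacePlane v)‖ ^ 2 < 2 ^ 2 := by
      have h2 : 0 < ‖e - e'‖ := norm_pos_iff.2 (sub_ne_zero.2 hne)
      have h3 := parallelogram_law_with_norm ℝ e e'
      rw [he, he'] at h3
      nlinarith
    have h2 := lt_of_pow_lt_pow_left₀ 2 (by norm_num) h1
    rw [norm_smul]
    norm_num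
    linarith
  · have h1 := hPu y
    have h2 := hQu y
    rw [real_inner_smul_left, inner_add_left]
    linarith

variable {v} {D : Set (Mink n)} {u : SpacePlane v → ℝ}

theorem IsEpigraph.mem_frontier_iff (h : IsEpigraph v D u) (hD : IsOpen D) (hu : Continuous u)
    (x : SpacePlane v) (t : ℝ) : splitPt v x t ∈ frontier D ↔ t = u x := by
  have hcont : Continuous fun s => splitPt v x s :=
    (continuous_splitPt v).comp (continuous_const.prodMk continuous_id)
  have hcl : IsClosed {q : Mink n | u ((splitEquiv v).symm q).1 ≤ ((splitEquiv v).symm q).2} :=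
    isClosed_le (hu.comp (continuous_fst.comp (splitEquiv v).symm.continuous))
      (continuous_snd.comp (splitEquiv v).symm.continuous)
  have hDc : closure D ⊆
      {q : Mink n | u ((splitEquiv v).symm q).1 ≤ ((splitEquiv v).symm q).2} := by
    refine closure_minimal (fun q hq => ?_) hcl
    obtain ⟨y, s, rfl⟩ := exists_splitPt v q
    rw [mem_ofPred_eq, ← splitEquiv_apply v (y, s), ContinuousLinearEquiv.symm_apply_apply]
    exact ((h y s).1 hq).le
  rw [hD.frontier_eq, Set.mem_sdiff, h x t, not_lt]
  constructor
  · rintro ⟨h1, h2⟩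
    have h3 := hDc h1
    rw [mem_ofPred_eq, ← splitEquiv_apply v (x, t), ContinuousLinearEquiv.symm_apply_apply] at h3
    exact le_antisymm h2 h3
  · rintro rfl
    refine ⟨?_, le_rfl⟩
    refine mem_closure_of_tendsto (f := fun s => splitPt v x s) (b := 𝓝[>] (u x))
      ((hcont.tendsto _).mono_left nhdsWithin_le_nhds) ?_
    filter_upwards [self_mem_nhdsWithin] with s hs
    exact (h x s).2 hs

theorem IsEpigraph.graphFun_frontier (h : IsEpigraph v D u) (hD : IsOpen D) (hu : Continuous u) :
    graphFun v (frontier D) = u := by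
  funext x
  have : {t : ℝ | SpacePlane.incl v x + t • v.1 ∈ frontier D} = {u x} := by
    ext t
    exact h.mem_frontier_iff hD hu x t
  rw [graphFun, this, csInf_singleton]

/-- Hausdorff convergence on compact sets implies pointwise convergence of the height functions. -/
theorem DomainsConverge.tendsto_height {Dk : ℕ → Set (Mink n)} {uk : ℕ → SpacePlane v → ℝ}
    (hconv : DomainsConverge Dk D) (hu : IsNullHeight u) (huk : ∀ k, IsNullHeight (uk k))
    (h : IsEpigraph v D u) (hk : ∀ k, IsEpigraph v (Dk k) (uk k)) (x : SpacePlane v) :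
    Tendsto (fun k => uk k x) atTop (𝓝 (u x)) := by
  -- points of an epigraph close to a point over `x` lie over points close to `x`
  have key : ∀ (t δ : ℝ), 0 < δ → ∃ η > 0, ∀ (D' : Set (Mink n)) (u' : SpacePlane v → ℝ),
      IsNullHeight u' → IsEpigraph v D' u' → splitPt v x t ∈ Metric.thickening η D' →
      u' x < t + δ := by
    intro t δ hδ
    have hc : Continuous fun q : Mink n => (splitEquiv v).symm q := (splitEquiv v).symm.continuous
    obtain ⟨η, hη, hη'⟩ := Metric.continuous_iff.1 hc (splitPt v x t) (δ / 2) (by positivity)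
    refine ⟨η, hη, fun D' u' hu' h' hmem => ?_⟩
    obtain ⟨q, hq, hdist⟩ := Metric.mem_thickening_iff.1 hmem
    obtain ⟨y, s, rfl⟩ := exists_splitPt v q
    have h1 := hη' _ (by rwa [dist_comm])
    rw [← splitEquiv_apply v (y, s), ← splitEquiv_apply v (x, t),
      ContinuousLinearEquiv.symm_apply_apply, ContinuousLinearEquiv.symm_apply_apply,
      Prod.dist_eq, max_lt_iff] at h1
    have h2 := (h' y s).1 hq
    have h3 := hu'.sub_le x y
    rw [← dist_eq_norm, dist_comm] at h3
    have h4 := (abs_lt.1 h1.2).2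
    simp only at h1 h4
    linarith [h1.1]
  refine tendsto_order.2 ⟨fun c hc => ?_, fun c hc => ?_⟩
  · obtain ⟨η, hη, hkey⟩ := key ((c + u x) / 2) ((u x - c) / 2) (by linarith)
    filter_upwards [hconv {splitPt v x ((c + u x) / 2)} isCompact_singleton η hη] with k hk'
    by_contra hle
    push Not at hle
    have := hkey D u hu h (hk'.1 ⟨(hk k x _).2 (by linarith), rfl⟩)
    linarith
  · obtain ⟨η, hη, hkey⟩ := key ((c + u x) / 2) ((c - u x) / 2) (by linarith)
    filter_upwards [hconv {splitPt v x ((c + u x) / 2)} isCompact_singleton η hη] with k hk'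
    have := hkey (Dk k) (uk k) (huk k) (hk k) (hk'.2 ⟨(h x _).2 (by linarith), rfl⟩)
    linarith

end Height

/-! ### The cosmological time of an epigraph -/

section CosmoTime

variable {n : ℕ}

/-- Reverse Cauchy–Schwarz against a unit timelike vector. -/
theorem sqrt_neg_mform_le {a w : Mink n} (ha : mform n a a ≤ 0) (ha0 : 0 < a 0)
    (hw : mform n w w = -1) (hw0 : 0 < w 0) : √(-(mform n a a)) ≤ -mform n a w := by
  set w' : Hyp n := ⟨w, hw, hw0⟩
  have hneg := mform_neg_of_causal ha ha0 (by rw [hw]; norm_num) hw0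
  obtain ⟨x, t, rfl⟩ := exists_splitPt w' a
  have h1 : mform n (splitPt w' x t) w = -t := mform_splitPt_dir w' x t
  rw [h1] at hneg ⊢
  rw [mform_splitPt_self]
  refine Real.sqrt_le_iff.2 ⟨by linarith, ?_⟩
  nlinarith [sq_nonneg ‖x‖]

/-- The length of a causal curve is at most the displacement along any unit timelike direction. -/
theorem IsCausalCurveTo.curveLength_le {D : Set (Mink n)} {p : Mink n} {c : ℝ → Mink n}
    (hc : IsCausalCurveTo D p c) {w : Mink n} (hw : mform n w w = -1) (hw0 : 0 < w 0) :
    curveLength c ≤ -mform n (p - c 0) w := by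
  have hcd : ContinuousOn (derivWithin c (Icc 0 1)) (Icc 0 1) :=
    hc.contDiffOn.continuousOn_derivWithin (uniqueDiffOn_Icc zero_lt_one) le_rfl
  set L : Mink n →L[ℝ] ℝ := LinearMap.toContinuousLinearMap (-(mform n).flip w) with hL
  have hLa : ∀ a, L a = -mform n a w := fun a => rfl
  have hm : Continuous fun a : Mink n => mform n a a := by
    simp only [mform_apply]
    fun_prop
  have hint : IntervalIntegrable (derivWithin c (Icc 0 1)) volume 0 1 :=
    ContinuousOn.intervalIntegrable (by rwa [uIcc_of_le zero_le_one])
  have hFTC : ∫ t in (0 : ℝ)..1, derivWithin c (Icc 0 1) t = c 1 - c 0 :=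
    intervalIntegral.integral_derivWithin_Icc_of_contDiffOn_Icc hc.contDiffOn zero_le_one
  calc curveLength c
      ≤ ∫ t in (0 : ℝ)..1, L (derivWithin c (Icc 0 1) t) := by
        refine intervalIntegral.integral_mono_on zero_le_one ?_ ?_ fun t ht => ?_
        · refine ContinuousOn.intervalIntegrable ?_
          rw [uIcc_of_le zero_le_one]
          exact (hm.comp_continuousOn hcd).neg.sqrt
        · refine ContinuousOn.intervalIntegrable ?_
          rw [uIcc_of_le zero_le_one]
          exact L.continuous.comp_continuousOn hcd
        · exact sqrt_neg_mform_le (hc.causal t ht) (hc.future t ht) hw hw0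
    _ = L (p - c 0) := by rw [L.intervalIntegral_comp_comm hint, hFTC, hc.endpoint]
    _ = -mform n (p - c 0) w := hLa _

/-- The cosmological time is bounded below by the length of straight segments. -/
theorem le_cosmoTime_of_chronPrec {D : Set (Mink n)} (hD : Convex ℝ D) {p q : Mink n} (hp : p ∈ D)
    (hq : q ∈ D) (h : ChronPrec q p) :
    ENNReal.ofReal √(-(mform n (p - q) (p - q))) ≤ cosmoTime D p := by
  set c : ℝ → Mink n := fun t => q + t • (p - q)
  have hcd : ∀ t ∈ Icc (0 : ℝ) 1, derivWithin c (Icc 0 1) t = p - q := by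
    intro t ht
    have h0 : HasDerivAt (fun s : ℝ => s • (p - q)) (p - q) t := by
      simpa using (hasDerivAt_id t).smul_const (p - q)
    have h1 : HasDerivAt c (p - q) t := h0.const_add q
    exact h1.hasDerivWithinAt.derivWithin (uniqueDiffOn_Icc zero_lt_one t ht)
  have hc : IsCausalCurveTo D p c := by
    refine ⟨?_, fun t ht => ?_, fun t ht => ?_, fun t ht => ?_, by simp [c]⟩
    · exact (contDiff_const.add (contDiff_id.smul contDiff_const)).contDiffOn
    · exact hD.add_smul_sub_mem hq hp ht
    · rw [hcd t ht]
      exact h.1.le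
    · rw [hcd t ht, Pi.sub_apply, sub_pos]
      exact h.2
  have hlen : curveLength c = √(-(mform n (p - q) (p - q))) := by
    rw [curveLength, intervalIntegral.integral_congr (g := fun _ => √(-(mform n (p - q) (p - q))))]
    · simp
    · intro t ht
      rw [uIcc_of_le zero_le_one] at ht
      simp only [hcd t ht]
  rw [← hlen]
  exact le_iSup₂_of_le c hc le_rfl

variable {v : Hyp n} {D : Set (Mink n)} {u : SpacePlane v → ℝ}

theorem IsEpigraph.le_cosmoTime (h : IsEpigraph v D u) (hD : Convex ℝ D) {x y : SpacePlane v}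
    {t : ℝ} (ht : u x < t) (hxy : ‖x - y‖ < t - u y) :
    ENNReal.ofReal √((t - u y) ^ 2 - ‖x - y‖ ^ 2) ≤ cosmoTime D (splitPt v x t) := by
  have hlim : Tendsto (fun s => ENNReal.ofReal √((t - s) ^ 2 - ‖x - y‖ ^ 2)) (𝓝[>] (u y))
      (𝓝 (ENNReal.ofReal √((t - u y) ^ 2 - ‖x - y‖ ^ 2))) := by
    have hc : Continuous fun s : ℝ => ENNReal.ofReal √((t - s) ^ 2 - ‖x - y‖ ^ 2) :=
      ENNReal.continuous_ofReal.comp (by fun_prop)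
    exact (hc.tendsto _).mono_left nhdsWithin_le_nhds
  refine le_of_tendsto hlim ?_
  filter_upwards [Ioo_mem_nhdsGT (show u y < t - ‖x - y‖ by linarith)] with s hs
  have h1 := le_cosmoTime_of_chronPrec hD ((h x t).2 ht) ((h y s).2 hs.1)
    ((chronPrec_splitPt v).2 (by linarith [hs.2]))
  rwa [splitPt_sub, mform_splitPt_self, neg_sub] at h1

/-- Upper bound for the cosmological time: the support plane at the foot bounds the displacement
of all curves along its unit normal. -/
theorem IsEpigraph.cosmoTime_le (h : IsEpigraph v D u) (hu : IsNullHeight u) {ε : ℝ} (hε : 0 < ε)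
    {x y : SpacePlane v} (hy : IsFoot u ε x y) {t : ℝ} (ht : t ≤ levelHeight u ε x) :
    cosmoTime D (splitPt v x t) ≤ ENNReal.ofReal (ε - (levelHeight u ε x - t)) := by
  refine iSup₂_le fun c hc => ENNReal.ofReal_le_ofReal ?_
  set N := softNorm ε (x - y) with hN
  have hNpos : 0 < N := softNorm_pos hε _
  have hN2 : N ^ 2 = ε ^ 2 + ‖x - y‖ ^ 2 := softNorm_sq ε _
  set w := splitPt v (ε⁻¹ • (x - y)) (ε⁻¹ * N)
  have hw : mform n w w = -1 := by
    rw [mform_splitPt_self, norm_smul, mul_pow, mul_pow, hN2, norm_inv, Real.norm_of_nonneg hε.le]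
    field_simp
    ring
  have hw0 : 0 < w 0 := by
    refine (splitPt_zero_pos_iff v ?_ (by positivity)).2 (by positivity)
    rw [← mform_splitPt_self]
    exact hw.le.trans (by norm_num)
  refine (hc.curveLength_le hw hw0).trans ?_
  have hc0 := hc.mapsTo (left_mem_Icc.2 zero_le_one)
  obtain ⟨z, s, hzs⟩ := exists_splitPt v (c 0)
  rw [← hzs] at hc0 ⊢
  have hs := (h z s).1 hc0
  have hsub := hy.isSubgrad hε hu z
  rw [splitPt_sub, mform_splitPt, real_inner_smul_right]
  have hlev := hy.levelHeight_eq
  rw [softGrad, real_inner_smul_left, ← hN] at hsub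
  have hsub' : N * u y + ⟪x - y, z - y⟫ ≤ N * u z := by
    have := mul_le_mul_of_nonneg_left hsub hNpos.le
    rwa [mul_add, mul_inv_cancel_left₀ hNpos.ne'] at this
  have hin : ⟪x - z, x - y⟫ = ‖x - y‖ ^ 2 - ⟪x - y, z - y⟫ := by
    rw [← real_inner_self_eq_norm_sq, ← inner_sub_right, real_inner_comm]
    congr 1
    abel
  have hNε : ε ≤ N := Real.le_sqrt_of_sq_le (by nlinarith [sq_nonneg ‖x - y‖])
  rw [hin]
  have h1 : N * (levelHeight u ε x - t) ≥ ε * (levelHeight u ε x - t) :=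
    mul_le_mul_of_nonneg_right hNε (by linarith)
  have h2 : N * (t - s) ≤ N * (t - u z) := mul_le_mul_of_nonneg_left (by linarith) hNpos.le
  have h3 : -(ε⁻¹ * (‖x - y‖ ^ 2 - ⟪x - y, z - y⟫) - (t - s) * (ε⁻¹ * N)) =
      (N * (t - s) - (‖x - y‖ ^ 2 - ⟪x - y, z - y⟫)) / ε := by
    field_simp
    ring
  rw [h3, div_le_iff₀ hε]
  rw [hlev, ← hN] at h1 ⊢
  nlinarith

/-- The level surface `H_ε` is the graph of `levelHeight u ε`. -/
theorem IsEpigraph.mem_levelSurface_iff (h : IsEpigraph v D u) (hD : Convex ℝ D)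
    (hu : IsNullHeight u) {ε : ℝ} (hε : 0 < ε) (x : SpacePlane v) (t : ℝ) :
    splitPt v x t ∈ levelSurface D ε ↔ t = levelHeight u ε x := by
  obtain ⟨y, hy⟩ := hu.exists_isFoot hε.le x
  have hlev := hy.levelHeight_eq
  have hlt := norm_lt_softNorm hε (x - y)
  have hN2 := softNorm_sq ε (x - y)
  have hgt : u x < levelHeight u ε x := by linarith [hu.sub_le x y]
  have hlow : ∀ s, levelHeight u ε x ≤ s →
      ENNReal.ofReal √((s - u y) ^ 2 - ‖x - y‖ ^ 2) ≤ cosmoTime D (splitPt v x s) := fun s hs =>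
    h.le_cosmoTime hD (hgt.trans_le hs) (by linarith)
  constructor
  · rintro ⟨-, hτ⟩
    rcases lt_trichotomy t (levelHeight u ε x) with hlt' | heq | hgt'
    · have h1 := h.cosmoTime_le hu hε hy hlt'.le
      rw [hτ] at h1
      have h2 := (ENNReal.ofReal_lt_ofReal_iff hε).2
        (show ε - (levelHeight u ε x - t) < ε by linarith)
      exact absurd h1 (not_le.2 h2)
    · exact heq
    · have h1 := hlow t hgt'.le
      have h2 : ε < √((t - u y) ^ 2 - ‖x - y‖ ^ 2) := by
        refine Real.lt_sqrt_of_sq_lt ?_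
        have : softNorm ε (x - y) ^ 2 < (t - u y) ^ 2 :=
          pow_lt_pow_left₀ (by linarith) (softNorm_nonneg _ _) two_ne_zero
        linarith
      rw [hτ] at h1
      exact absurd h1 (not_le.2 ((ENNReal.ofReal_lt_ofReal_iff (hε.trans h2)).2 h2))
  · rintro rfl
    refine ⟨(h x _).2 hgt, le_antisymm ?_ ?_⟩
    · simpa using h.cosmoTime_le hu hε hy le_rfl
    · have h1 := hlow _ le_rfl
      have h2 : (levelHeight u ε x - u y) ^ 2 - ‖x - y‖ ^ 2 = ε ^ 2 := by
        rw [hlev, add_sub_cancel_left, hN2, add_sub_cancel_right]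
      rwa [h2, Real.sqrt_sq hε.le] at h1

theorem IsEpigraph.graphFun_levelSurface (h : IsEpigraph v D u) (hD : Convex ℝ D)
    (hu : IsNullHeight u) {ε : ℝ} (hε : 0 < ε) :
    graphFun v (levelSurface D ε) = levelHeight u ε := by
  funext x
  have : {t : ℝ | SpacePlane.incl v x + t • v.1 ∈ levelSurface D ε} = {levelHeight u ε x} := by
    ext t
    exact h.mem_levelSurface_iff hD hu hε x t
  rw [graphFun, this, csInf_singleton]

/-- The rescaled intensity of `H_ε` is the vertical distance to the foot. -/
theorem IsEpigraph.levelIntensity_eq (h : IsEpigraph v D u) (hD : Convex ℝ D)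
    (hu : IsNullHeight u) {ε : ℝ} (hε : 0 < ε) {x y : SpacePlane v} (hy : IsFoot u ε x y) :
    levelIntensity v D ε x = softNorm ε (x - y) := by
  have hgrad : gradient (levelHeight u ε) x = softGrad ε (x - y) := by
    rw [gradient, (hy.hasFDerivAt_levelHeight hε hu).fderiv]
    exact (InnerProductSpace.toDual ℝ (SpacePlane v)).symm_apply_apply _
  set N := softNorm ε (x - y) with hN
  have hNpos : 0 < N := softNorm_pos hε _
  have hN2 : N ^ 2 = ε ^ 2 + ‖x - y‖ ^ 2 := softNorm_sq ε _
  have h1 : 1 - ‖softGrad ε (x - y)‖ ^ 2 = (ε / N) ^ 2 := by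
    rw [softGrad, ← hN, norm_smul, mul_pow, norm_inv, Real.norm_of_nonneg hNpos.le]
    field_simp
    linarith
  have h2 : mform n (SpacePlane.incl v (softGrad ε (x - y)) + v.1) v.1 = -1 := by
    have := mform_splitPt_dir v (softGrad ε (x - y)) 1
    rwa [splitPt, one_smul] at this
  rw [levelIntensity, unitNormal, h.graphFun_levelSurface hD hu hε, hgrad, h1,
    Real.sqrt_sq (by positivity), map_smul, LinearMap.smul_apply, h2, smul_eq_mul]
  field_simp

/-- The intensity function is the null length of the boundary. -/
theorem IsEpigraph.intensity_eq (h : IsEpigraph v D u) (hD : Convex ℝ D)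
    (hu : IsNullHeight u) : intensity v D = nullLength u := by
  funext x
  choose! Y hY using fun (ε : ℝ) (hε : 0 < ε) => hu.exists_isFoot hε.le x
  refine Tendsto.limUnder_eq ((hu.tendsto_softNorm_foot hY).congr' ?_)
  filter_upwards [self_mem_nhdsWithin] with ε hε
  exact (h.levelIntensity_eq hD hu hε (hY ε hε)).symm

/-- The boundary has a spacelike support plane at the points of the initial singularity, so that no
null segment of the boundary ends there. -/
theorem IsEpigraph.nullLength_eq_zero (h : IsEpigraph v D u) (hD : Convex ℝ D)
    (hu : IsNullHeight u) {x : SpacePlane v} (hx : splitPt v x (u x) ∈ initialSingularity D) :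
    nullLength u x = 0 := by
  obtain ⟨-, p, hp, hxp, hτ⟩ := hx
  obtain ⟨z, t, rfl⟩ := exists_splitPt v p
  rw [chronPrec_splitPt] at hxp
  have hzt := (h z t).1 hp
  rw [splitPt_sub, mform_splitPt_self, neg_sub] at hτ
  have hpos : 0 < (t - u x) ^ 2 - ‖z - x‖ ^ 2 := by
    have := pow_lt_pow_left₀ hxp (norm_nonneg _) two_ne_zero
    linarith
  set ε := √((t - u x) ^ 2 - ‖z - x‖ ^ 2)
  have hε : 0 < ε := Real.sqrt_pos.2 hpos
  have hε2 : ε ^ 2 = (t - u x) ^ 2 - ‖z - x‖ ^ 2 := Real.sq_sqrt hpos.le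
  have hNx : softNorm ε (z - x) = t - u x := by
    rw [softNorm, hε2, sub_add_cancel, Real.sqrt_sq ((norm_nonneg _).trans hxp.le)]
  have hfoot : IsFoot u ε z x := by
    intro y
    rw [hNx, add_sub_cancel]
    rcases lt_or_ge ‖z - y‖ (t - u y) with hy | hy
    · have h1 := h.le_cosmoTime hD hzt hy
      rw [hτ, ENNReal.ofReal_le_ofReal_iff hε.le, Real.sqrt_le_left hε.le] at h1
      have h2 : t - u y ≤ softNorm ε (z - y) := Real.le_sqrt_of_sq_le (by linarith)
      linarith
    · linarith [norm_lt_softNorm hε (z - y)]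
  exact hu.nullLength_eq_zero_of_isSubgrad (hfoot.isSubgrad hε hu) (norm_softGrad_lt_one hε _)

end CosmoTime

end FlatSpacetime

theorem mainTheorem1 {n : ℕ} (v : FlatSpacetime.Hyp n)
    (D : Set (FlatSpacetime.Mink n)) (Dk : ℕ → Set (FlatSpacetime.Mink n))
    (hD : FlatSpacetime.IsDomainOfDependence D)
    (hDk : ∀ k, FlatSpacetime.IsDomainOfDependence (Dk k))
    (hconv : FlatSpacetime.DomainsConverge Dk D)
    (hflat : FlatSpacetime.HasFlatBoundary v D)
    (hflatk : ∀ k, FlatSpacetime.HasFlatBoundary v (Dk k)) :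
    LocallyIntegrable (FlatSpacetime.intensity v D) volume ∧
    (∀ k, LocallyIntegrable (FlatSpacetime.intensity v (Dk k)) volume) ∧
    ∀ K : Set (FlatSpacetime.SpacePlane v), IsCompact K →
      Tendsto (fun k => ∫ x in K,
          |FlatSpacetime.intensity v (Dk k) x - FlatSpacetime.intensity v D x|)
        atTop (𝓝 0) := by
  obtain ⟨u, hu, hep⟩ := hD.exists_isNullHeight v
  choose uk huk hepk using fun k => (hDk k).exists_isNullHeight v
  obtain ⟨μ, hμfin, hμ, hμT⟩ := hflat
  rw [hep.graphFun_frontier hD.isOpen hu.continuous] at hμ hμT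
  have hlim := hconv.tendsto_height hu huk hep hepk
  have hμ0 : ∀ᵐ x ∂μ, FlatSpacetime.nullLength u x = 0 := by
    filter_upwards [ae_iff.2 hμT] with x hx
    exact hep.nullLength_eq_zero hD.convex hu hx
  simp_rw [fun k => (hepk k).intensity_eq (hDk k).convex (huk k), hep.intensity_eq hD.convex hu]
  exact ⟨hu.locallyIntegrable_nullLength, fun k => (huk k).locallyIntegrable_nullLength,
    fun K hK => hu.tendsto_setIntegral_abs_nullLength_sub huk hlim hμ hμ0 hK⟩
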